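/- For every integer $r\ge 0$ there is a nonzero integer $c_r$ such that for every associative unital ring $R$ and every $n$ with $0\le n\le r$, multiplication by $c_r$ is zero on the homology group $H_n(\operatorname{Ker}\kappa^r_R)$, where $\kappa^r_R : C(\mathfrak{gl}_r(R))\to \mathrm{Sym}(C^\lambda(R)[1])$ is the Loday–Quillen–Tsygan morphism of complexes of abelian groups, and $\operatorname{Ker}\kappa^r_R$ is its kernel, a subcomplex of $C(\mathfrak{gl}_r(R))$. Here all tensor products are over $\mathbb Z$, and: (1) $\mathfrak{gl}_r(R)$ is the Lie ring of $r\times r$ matrices over $R$ with bracket $[x,y]=xy-yx$. For a Lie ring $\mathfrak g$, $C(\mathfrak g)$ is the Chevalley complex: $C(\mathfrak g)_n=\Lambda^n\mathfrak g$ is $(\mathfrak g[1]^{\otimes n})_{\Sigma_n}$, i.e. the quotient of $\mathfrak g^{\otimes n}$ by the relations $x_{\sigma(1)}\otimes\dots\otimes x_{\sigma(n)}=\mathrm{sgn}(\sigma)\,x_1\otimes\dots\otimes x_n$, and $$d(x_1\wedge\dots\wedge x_n)=\sum_{i<j}(-1)^{i+j-1}[x_i,x_j]\wedge x_1\wedge\dots\widehat{x_i}\dots\widehat{x_j}\dots\wedge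 x_n .$$ (2) $C^\lambda(R)$ is the Connes complex: for $n\ge 0$, $C^\lambda_n(R)$ is the quotient of $R^{\otimes(n+1)}$ by the relations $a_n\otimes a_0\otimes\dots\otimes a_{n-1}=(-1)^n a_0\otimes\dots\otimes a_n$, with differential induced by the Hochschild differential $$b(a_0\otimes\dots\otimes a_n)=\sum_{i=0}^{n-1}(-1)^i a_0\otimes\dots\otimes a_ia_{i+1}\otimes\dots\otimes a_n+(-1)^n a_na_0\otimes a_1\otimes\dots\otimes a_{n-1}.$$ In $C^\lambda(R)[1]$ the class $[a_1\otimes\dots\otimes a_l]$ has degree $l$. (3) $\mathrm{Sym}(C^\lambda(R)[1])$ is the tensor algebra of the graded group $C^\lambda(R)[1]$ modulo the relations $uv=(-1)^{|u||v|}vu$ for homogeneous $u,v$, with the differential $d$ that extends $b$ and satisfies $d(uv)=d(u)v+(-1)^{|u|}u\,d(v)$. (4) For $x_1,\dots,x_n\in\mathfrak{gl}_r(R)$, $$\kappa^r_R(x_1\wedge\dots\wedge x_n)=\sum_{\sigma\in\Sigma_n}\epsilon_\sigma\prod_{(i_1\,i_2\cdots i_l)}\ \sum_{a_1,\dots,a_l=1}^r\big[(x_{i_1})_{a_1a_2}\otimes(x_{i_2})_{a_2a_3}\otimes\dots\otimes(x_{i_l})_{a_la_1}\big],$$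 the product being over the cycles of $\sigma$ (fixed points included), and $\epsilon_\sigma$ being the sign of the permutation that rearranges $1,\dots,n$ into the order in which the indices appear when the cycles are written one after another (the summand does not depend on how the cycles are written and ordered). -/

import Mathlib

namespace LQT

open TensorAlgebra (ι)

section Words

variable {k V N : Type*} [CommRing k] [AddCommGroup V] [Module k V] [AddCommGroup N] [Module k N]

/-- Auxiliary to `wordRec`. -/
def wordRecAux (f : V →ₗ[k] TensorAlgebra k V × N →ₗ[k] N) :
    TensorAlgebra k V →ₐ[k] Module.End k (TensorAlgebra k V × N) :=
  TensorAlgebra.lift k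
    { toFun := fun x =>
        ((LinearMap.mulLeft k (ι k x)).comp (LinearMap.fst k _ _)).prod (f x)
      map_add' := fun x y => by ext <;> simp [add_mul]
      map_smul' := fun c x => by ext <;> simp }

/-- Primitive recursion on words from the left: the linear map `F` on the tensor algebra with
`F 1 = n₀` and `F (x ⊗ w) = f x (w, F w)`. -/
def wordRec (n₀ : N) (f : V →ₗ[k] TensorAlgebra k V × N →ₗ[k] N) : TensorAlgebra k V →ₗ[k] N :=
  (LinearMap.snd k _ _).comp ((LinearMap.applyₗ (1, n₀)).comp (wordRecAux f).toLinearMap)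

theorem wordRecAux_fst (f : V →ₗ[k] TensorAlgebra k V × N →ₗ[k] N)
    (w : TensorAlgebra k V) (p : TensorAlgebra k V × N) :
    (wordRecAux f w p).1 = w * p.1 := by
  induction w using TensorAlgebra.induction generalizing p with
  | algebraMap r => simp [Algebra.smul_def]
  | ι x => simp [wordRecAux]
  | mul a b ha hb => simp [ha, hb, mul_assoc]
  | add a b ha hb => simp [ha, hb, add_mul]

@[simp] theorem wordRec_one (n₀ : N) (f : V →ₗ[k] TensorAlgebra k V × N →ₗ[k] N) :
    wordRec n₀ f 1 = n₀ := by simp [wordRec]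

@[simp] theorem wordRec_mul (n₀ : N) (f : V →ₗ[k] TensorAlgebra k V × N →ₗ[k] N) (x : V)
    (w : TensorAlgebra k V) : wordRec n₀ f (ι k x * w) = f x (w, wordRec n₀ f w) := by
  have h : wordRecAux f w (1, n₀) = (w, wordRec n₀ f w) := by
    ext
    · simp [wordRecAux_fst f]
    · simp [wordRec]
  change (wordRecAux f (ι k x * w) (1, n₀)).2 = _
  rw [map_mul, Module.End.mul_apply, h]
  simp [wordRecAux]

/-- Words can be treated by induction on the first letter. -/
theorem word_induction {P : TensorAlgebra k V → Prop} (one : P 1)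
    (add : ∀ a b, P a → P b → P (a + b)) (smul : ∀ (c : k) a, P a → P (c • a))
    (mul : ∀ x w, P w → P (ι k x * w)) (w : TensorAlgebra k V) : P w := by
  suffices h : ∀ w v, P v → P (w * v) by simpa using h w 1 one
  intro w
  induction w using TensorAlgebra.induction with
  | algebraMap r => intro v hv; simpa [Algebra.smul_def] using smul r v hv
  | ι x => exact mul x
  | mul a b ha hb => intro v hv; rw [mul_assoc]; exact ha _ (hb _ hv)
  | add a b ha hb => intro v hv; rw [add_mul]; exact add _ _ (ha _ hv) (hb _ hv)

/-- Words can be treated by induction on the last letter. -/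
theorem word_induction_right {P : TensorAlgebra k V → Prop} (one : P 1)
    (add : ∀ a b, P a → P b → P (a + b)) (smul : ∀ (c : k) a, P a → P (c • a))
    (mul : ∀ x w, P w → P (w * ι k x)) (w : TensorAlgebra k V) : P w := by
  suffices h : ∀ w v, P v → P (v * w) by simpa using h w 1 one
  intro w
  induction w using TensorAlgebra.induction with
  | algebraMap r =>
    intro v hv
    rw [← Algebra.commutes, ← Algebra.smul_def]
    exact smul r v hv
  | ι x => exact mul x
  | mul a b ha hb => intro v hv; rw [← mul_assoc]; exact hb _ (ha _ hv)
  | add a b ha hb => intro v hv; rw [mul_add]; exact add _ _ (ha _ hv) (hb _ hv)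

/-- Auxiliary to `wordRecRight`. -/
def wordRecRightAux (f : V →ₗ[k] TensorAlgebra k V × N →ₗ[k] N) :
    TensorAlgebra k V →ₐ[k] (Module.End k (TensorAlgebra k V × N))ᵐᵒᵖ :=
  TensorAlgebra.lift k
    { toFun := fun x => MulOpposite.op
        (((LinearMap.mulRight k (ι k x)).comp (LinearMap.fst k _ _)).prod (f x))
      map_add' := fun x y => by rw [← MulOpposite.op_add]; congr 1; ext <;> simp [mul_add]
      map_smul' := fun c x => by rw [← MulOpposite.op_smul]; congr 1; ext <;> simp }

/-- Primitive recursion on words from the right: the linear map `F` on the tensor algebra with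
`F 1 = n₀` and `F (w ⊗ x) = f x (w, F w)`. -/
def wordRecRight (n₀ : N) (f : V →ₗ[k] TensorAlgebra k V × N →ₗ[k] N) :
    TensorAlgebra k V →ₗ[k] N :=
  (LinearMap.snd k _ _).comp ((LinearMap.applyₗ (1, n₀)).comp
    ((MulOpposite.opLinearEquiv k).symm.toLinearMap.comp (wordRecRightAux f).toLinearMap))

theorem wordRecRightAux_fst (f : V →ₗ[k] TensorAlgebra k V × N →ₗ[k] N)
    (w : TensorAlgebra k V) (p : TensorAlgebra k V × N) :
    ((wordRecRightAux f w).unop p).1 = p.1 * w := by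
  induction w using TensorAlgebra.induction generalizing p with
  | algebraMap r => simp [MulOpposite.algebraMap_apply, ← Algebra.commutes, Algebra.smul_def]
  | ι x => simp [wordRecRightAux]
  | mul a b ha hb => simp [ha, hb, mul_assoc]
  | add a b ha hb => simp [ha, hb, mul_add]

@[simp] theorem wordRecRight_one (n₀ : N) (f : V →ₗ[k] TensorAlgebra k V × N →ₗ[k] N) :
    wordRecRight n₀ f 1 = n₀ := by simp [wordRecRight]

@[simp] theorem wordRecRight_mul (n₀ : N) (f : V →ₗ[k] TensorAlgebra k V × N →ₗ[k] N) (x : V)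
    (w : TensorAlgebra k V) :
    wordRecRight n₀ f (w * ι k x) = f x (w, wordRecRight n₀ f w) := by
  have h : (wordRecRightAux f w).unop (1, n₀) = (w, wordRecRight n₀ f w) := by
    ext
    · simp [wordRecRightAux_fst f]
    · simp [wordRecRight]
  change ((wordRecRightAux f (w * ι k x)).unop (1, n₀)).2 = _
  rw [map_mul, MulOpposite.unop_mul, Module.End.mul_apply, h]
  simp [wordRecRightAux]

variable (k V) in
/-- The words of length `n`: the copy of `V^{⊗ n}` inside the tensor algebra. -/
abbrev wordDeg (n : ℕ) : Submodule k (TensorAlgebra k V) := LinearMap.range (ι k (M := V)) ^ n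

variable (k V) in
/-- The sign automorphism of the tensor algebra: multiplication by `(-1)^n` on words of length
`n`. -/
def wordSign : TensorAlgebra k V →ₐ[k] TensorAlgebra k V := TensorAlgebra.lift k (-ι k)

@[simp] theorem wordSign_ι (x : V) : wordSign k V (ι k x) = -ι k x := by simp [wordSign]

@[simp] theorem wordSign_wordSign (w : TensorAlgebra k V) :
    wordSign k V (wordSign k V w) = w := by
  induction w using word_induction with
  | one => simp
  | add a b ha hb => simp [ha, hb]
  | smul c a ha => simp [ha]
  | mul x w hw => simp [hw]

theorem one_mem_wordDeg : (1 : TensorAlgebra k V) ∈ wordDeg k V 0 := by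
  simp [wordDeg, Submodule.one_le.1 le_rfl]

theorem ι_mem_wordDeg (x : V) : ι k x ∈ wordDeg k V 1 := by simp [wordDeg]

theorem mul_mem_wordDeg {m n : ℕ} {a b : TensorAlgebra k V} (ha : a ∈ wordDeg k V m)
    (hb : b ∈ wordDeg k V n) : a * b ∈ wordDeg k V (m + n) := by
  rw [wordDeg, pow_add]; exact Submodule.mul_mem_mul ha hb

theorem ι_mul_mem_wordDeg {n : ℕ} (x : V) {b : TensorAlgebra k V}
    (hb : b ∈ wordDeg k V n) : ι k x * b ∈ wordDeg k V (n + 1) := by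
  rw [add_comm]; exact mul_mem_wordDeg (ι_mem_wordDeg x) hb

theorem mul_ι_mem_wordDeg {n : ℕ} (x : V) {b : TensorAlgebra k V}
    (hb : b ∈ wordDeg k V n) : b * ι k x ∈ wordDeg k V (n + 1) :=
  mul_mem_wordDeg hb (ι_mem_wordDeg x)

/-- Induction on words of a fixed length, from the left. -/
theorem wordDeg_induction {P : ℕ → TensorAlgebra k V → Prop} (one : P 0 1)
    (add : ∀ n a b, P n a → P n b → P n (a + b)) (smul : ∀ n (c : k) a, P n a → P n (c • a))
    (mul : ∀ n x w, w ∈ wordDeg k V n → P n w → P (n + 1) (ι k x * w)) {n : ℕ}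
    {w : TensorAlgebra k V} (hw : w ∈ wordDeg k V n) : P n w := by
  induction hw using Submodule.pow_induction_on_left' with
  | algebraMap r => rw [Algebra.algebraMap_eq_smul_one]; exact smul _ _ _ one
  | add x y i hx hy h1 h2 => exact add _ _ _ h1 h2
  | mem_mul m hm i x hx h => obtain ⟨m, rfl⟩ := hm; exact mul _ _ _ hx h

/-- Induction on words of a fixed length, from the right. -/
theorem wordDeg_induction_right {P : ℕ → TensorAlgebra k V → Prop} (one : P 0 1)
    (add : ∀ n a b, P n a → P n b → P n (a + b)) (smul : ∀ n (c : k) a, P n a → P n (c • a))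
    (mul : ∀ n x w, w ∈ wordDeg k V n → P n w → P (n + 1) (w * ι k x)) {n : ℕ}
    {w : TensorAlgebra k V} (hw : w ∈ wordDeg k V n) : P n w := by
  induction hw using Submodule.pow_induction_on_right' with
  | algebraMap r => rw [Algebra.algebraMap_eq_smul_one]; exact smul _ _ _ one
  | add x y i hx hy h1 h2 => exact add _ _ _ h1 h2
  | mul_mem i x hx h m hm => obtain ⟨m, rfl⟩ := hm; exact mul _ _ _ hx h

theorem wordSign_of_mem {n : ℕ} {w : TensorAlgebra k V} (hw : w ∈ wordDeg k V n) :
    wordSign k V w = (-1 : k) ^ n • w := by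
  refine wordDeg_induction (P := fun n w => wordSign k V w = (-1 : k) ^ n • w) ?_ ?_ ?_ ?_ hw
  · simp
  · intro n a b ha hb; simp [ha, hb]
  · intro n c a ha; simp [ha, smul_comm c]
  · intro n x w _ hw; simp [hw, pow_succ]

end Words

section Connes

variable (k : Type*) {M : Type*} [CommRing k] [Ring M] [Algebra k M]

/-- `headMul k w x` multiplies the first letter of the word `w` by `x` on the left:
`headMul (y ⊗ w) x = (x y) ⊗ w`, and `headMul 1 x = 0`. -/
def headMul : TensorAlgebra k M →ₗ[k] M →ₗ[k] TensorAlgebra k M :=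
  wordRec 0 (LinearMap.mk₂ k
    (fun y p => (LinearMap.mulRight k p.1).comp ((ι k).comp (LinearMap.mulRight k y)))
    (fun y y' p => by ext; simp [mul_add, add_mul]) (fun c y p => by ext; simp)
    (fun y p p' => by ext; simp [mul_add]) (fun c y p => by ext; simp))

@[simp] theorem headMul_one (x : M) : headMul k 1 x = 0 := by simp [headMul]

@[simp] theorem headMul_mul (x y : M) (w : TensorAlgebra k M) :
    headMul k (ι k y * w) x = ι k (x * y) * w := by simp [headMul]

@[simp] theorem headMul_ι (x y : M) : headMul k (ι k y) x = ι k (x * y) := by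
  simpa using headMul_mul k x y 1

variable (M) in
/-- The operator `b'` on words:
`b' (x₀ ⊗ ⋯ ⊗ xₙ) = ∑_{0 ≤ i < n} (-1)^i x₀ ⊗ ⋯ ⊗ xᵢ xᵢ₊₁ ⊗ ⋯ ⊗ xₙ`, defined by
`b' (x ⊗ w) = headMul w x - x ⊗ b' w`. -/
def barD : TensorAlgebra k M →ₗ[k] TensorAlgebra k M :=
  wordRec 0 (LinearMap.mk₂ k
    (fun x p => headMul k p.1 x - ι k x * p.2)
    (fun y y' p => by simp [add_mul]; abel) (fun c y p => by simp [smul_sub])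
    (fun y p p' => by simp [mul_add]; abel) (fun c y p => by simp [smul_sub]))

@[simp] theorem barD_one : barD k M 1 = 0 := by simp [barD]

@[simp] theorem barD_mul (x : M) (w : TensorAlgebra k M) :
    barD k M (ι k x * w) = headMul k w x - ι k x * barD k M w := by simp [barD]

@[simp] theorem barD_ι (x : M) : barD k M (ι k x) = 0 := by
  simpa using barD_mul k x 1

variable (M) in
/-- The last face, with its sign: `x₀ ⊗ ⋯ ⊗ xₙ ↦ (-1)^n xₙ x₀ ⊗ x₁ ⊗ ⋯ ⊗ xₙ₋₁` for `n ≥ 1`, and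
`0` on words of length `≤ 1`. -/
def lastFace : TensorAlgebra k M →ₗ[k] TensorAlgebra k M :=
  wordRecRight 0 (LinearMap.mk₂ k
    (fun y p => headMul k (wordSign k M p.1) y)
    (fun y y' p => by simp) (fun c y p => by simp)
    (fun y p p' => by simp) (fun c y p => by simp))

@[simp] theorem lastFace_one : lastFace k M 1 = 0 := by simp [lastFace]

@[simp] theorem lastFace_mul (x : M) (w : TensorAlgebra k M) :
    lastFace k M (w * ι k x) = headMul k (wordSign k M w) x := by simp [lastFace]

@[simp] theorem lastFace_ι (x : M) : lastFace k M (ι k x) = 0 := by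
  simpa using lastFace_mul k x 1

variable (M) in
/-- The Hochschild differential `b` on words:
`b (x₀ ⊗ ⋯ ⊗ xₙ) = ∑_{0 ≤ i < n} (-1)^i x₀ ⊗ ⋯ ⊗ xᵢ xᵢ₊₁ ⊗ ⋯ ⊗ xₙ + (-1)^n xₙ x₀ ⊗ ⋯ ⊗ xₙ₋₁`. -/
def hochschildD : TensorAlgebra k M →ₗ[k] TensorAlgebra k M := barD k M + lastFace k M

variable (M) in
/-- The relations defining the Connes complex: constants (there are no words of length zero), and
`t ∼ (-1)^n` (rotation of `t`), i.e. `x₀ ⊗ x₁ ⊗ ⋯ ⊗ xₙ ∼ (-1)^n x₁ ⊗ ⋯ ⊗ xₙ ⊗ x₀`. -/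
def connesRel : Submodule k (TensorAlgebra k M) :=
  Submodule.span k ({1} ∪ {t | ∃ (x : M) (w : TensorAlgebra k M),
    t = ι k x * w - wordSign k M w * ι k x})

variable (M) in
/-- The total module `⨁ₙ C^λₙ(M)` of the Connes complex of `M`: `C^λₙ(M)` is the module of
coinvariants of `ℤ/(n+1)` acting on `M^{⊗ (n+1)}` by signed cyclic permutations. -/
abbrev Connes : Type _ := TensorAlgebra k M ⧸ connesRel k M

/-- The class of a word in the Connes complex. -/
def cyc : TensorAlgebra k M →ₗ[k] Connes k M := (connesRel k M).mkQ

variable (M) in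
/-- `connesDeg k M n` is the degree `n` part of the shifted Connes complex `C^λ(M)[1]`, i.e. the
classes of words of length `n`: it is `C^λₙ₋₁(M)` for `n ≥ 1` and `0` for `n = 0`. -/
def connesDeg (n : ℕ) : Submodule k (Connes k M) := (wordDeg k M n).map (cyc k)

@[simp] theorem cyc_one : cyc k (1 : TensorAlgebra k M) = 0 :=
  (Submodule.Quotient.mk_eq_zero _).2 (Submodule.subset_span (Or.inl rfl))

theorem cyc_rotate (x : M) (w : TensorAlgebra k M) :
    cyc k (ι k x * w) = cyc k (wordSign k M w * ι k x) :=
  (Submodule.Quotient.eq _).2 (Submodule.subset_span (Or.inr ⟨x, w, rfl⟩))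

/-- A linear map on words which kills constants and is invariant under signed rotation descends
to the Connes complex. -/
def connesLift {N : Type*} [AddCommGroup N] [Module k N] (f : TensorAlgebra k M →ₗ[k] N)
    (h1 : f 1 = 0) (h : ∀ x w, f (ι k x * w) = f (wordSign k M w * ι k x)) :
    Connes k M →ₗ[k] N :=
  (connesRel k M).liftQ f (Submodule.span_le.2 (by
    rintro _ (rfl | ⟨x, w, rfl⟩)
    · exact h1
    · simp [h x w]))

@[simp] theorem connesLift_cyc {N : Type*} [AddCommGroup N] [Module k N]
    (f : TensorAlgebra k M →ₗ[k] N) (h1 : f 1 = 0)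
    (h : ∀ x w, f (ι k x * w) = f (wordSign k M w * ι k x)) (w : TensorAlgebra k M) :
    connesLift k f h1 h (cyc k w) = f w := rfl

/-- `tailMul k x w` multiplies the last letter of `w` by `x` on the right. -/
def tailMul (x : M) : TensorAlgebra k M →ₗ[k] TensorAlgebra k M :=
  wordRecRight 0 (LinearMap.mk₂ k (fun y p => p.1 * ι k (y * x))
    (fun y y' p => by simp [mul_add, add_mul]) (fun c y p => by simp)
    (fun y p p' => by simp [add_mul]) (fun c y p => by simp))

@[simp] theorem tailMul_one (x : M) : tailMul k x 1 = 0 := by simp [tailMul]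

@[simp] theorem tailMul_mul (x y : M) (w : TensorAlgebra k M) :
    tailMul k x (w * ι k y) = w * ι k (y * x) := by simp [tailMul]

@[simp] theorem tailMul_ι (x y : M) : tailMul k x (ι k y) = ι k (y * x) := by
  simpa using tailMul_mul k x y 1

variable {k} in
/-- Case distinction on the first letter of a word. -/
theorem word_cases_left {P : TensorAlgebra k M → Prop} (one : P 1)
    (add : ∀ a b, P a → P b → P (a + b)) (smul : ∀ (c : k) a, P a → P (c • a))
    (mul : ∀ x w, P (ι k x * w)) (w : TensorAlgebra k M) : P w :=
  word_induction one add smul (fun x w _ => mul x w) w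

variable {k} in
/-- Case distinction on the last letter of a word. -/
theorem word_cases_right {P : TensorAlgebra k M → Prop} (one : P 1)
    (add : ∀ a b, P a → P b → P (a + b)) (smul : ∀ (c : k) a, P a → P (c • a))
    (mul : ∀ x w, P (w * ι k x)) (w : TensorAlgebra k M) : P w :=
  word_induction_right one add smul (fun x w _ => mul x w) w

variable {k} in
/-- A word is constant, a letter, or has distinct first and last letters. -/
theorem word_cases {P : TensorAlgebra k M → Prop} (one : P 1)
    (add : ∀ a b, P a → P b → P (a + b)) (smul : ∀ (c : k) a, P a → P (c • a))
    (single : ∀ x, P (ι k x)) (mul : ∀ x w y, P (ι k x * (w * ι k y)))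
    (w : TensorAlgebra k M) : P w := by
  refine word_cases_left one add smul (fun x w => ?_) w
  induction w using word_cases_right with
  | one => simpa using single x
  | add a b ha hb => rw [mul_add]; exact add _ _ ha hb
  | smul c a ha => rw [mul_smul_comm]; exact smul _ _ ha
  | mul y w => exact mul x w y

theorem headMul_wordSign (x : M) (w : TensorAlgebra k M) :
    headMul k (wordSign k M w) x = wordSign k M (headMul k w x) := by
  induction w using word_cases_left with
  | one => simp
  | add a b ha hb => simp [ha, hb]
  | smul c a ha => simp [ha]
  | mul y w => simp

theorem tailMul_wordSign (x : M) (w : TensorAlgebra k M) :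
    tailMul k x (wordSign k M w) = wordSign k M (tailMul k x w) := by
  induction w using word_cases_right with
  | one => simp
  | add a b ha hb => simp [ha, hb]
  | smul c a ha => simp [ha]
  | mul y w => simp

theorem headMul_mul_ι (x y z : M) (w : TensorAlgebra k M) :
    headMul k (w * ι k y * ι k z) x = headMul k (w * ι k y) x * ι k z := by
  induction w using word_cases_left with
  | one => simp
  | add a b ha hb => simp [add_mul, ha, hb]
  | smul c a ha => simp [ha]
  | mul a w => simp [mul_assoc]

theorem tailMul_ι_mul (x y z : M) (w : TensorAlgebra k M) :
    tailMul k x (ι k y * (ι k z * w)) = ι k y * tailMul k x (ι k z * w) := by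
  induction w using word_cases_right with
  | one => rw [mul_one, tailMul_mul, tailMul_ι]
  | add a b ha hb => simp [mul_add, ha, hb]
  | smul c a ha => simp [ha]
  | mul a w => rw [← mul_assoc, ← mul_assoc, tailMul_mul, ← mul_assoc, tailMul_mul]; simp [mul_assoc]

theorem barD_wordSign (w : TensorAlgebra k M) :
    barD k M (wordSign k M w) = -wordSign k M (barD k M w) := by
  induction w using word_induction with
  | one => simp
  | add a b ha hb => simp [ha, hb]; abel
  | smul c a ha => simp [ha]
  | mul x w hw => simp [hw, headMul_wordSign]

/-- The operator `b'` in terms of the last letter. -/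
theorem barD_mul_right (z : M) (w : TensorAlgebra k M) :
    barD k M (w * ι k z) = barD k M w * ι k z - tailMul k z (wordSign k M w) := by
  induction w using word_induction with
  | one => simp
  | add a b ha hb => simp [add_mul, ha, hb]; abel
  | smul c a ha => simp [ha, smul_sub]
  | mul y w hw =>
    have key : headMul k (w * ι k z) y + ι k y * tailMul k z (wordSign k M w) =
        headMul k w y * ι k z + tailMul k z (ι k y * wordSign k M w) := by
      clear hw
      induction w using word_cases_right with
      | one => simp
      | add a b ha hb => simp only [add_mul, map_add, LinearMap.add_apply, mul_add] at *; rw [add_add_add_comm, ha, hb]; abel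
      | smul c a ha => simp only [smul_mul_assoc, map_smul, LinearMap.smul_apply, mul_smul_comm, ← smul_add, ha]
      | mul a w =>
        rw [headMul_mul_ι]
        rw [map_mul (wordSign k M), wordSign_ι, mul_neg, map_neg, tailMul_mul, mul_neg, mul_neg,
          map_neg, ← mul_assoc, ← mul_assoc, tailMul_mul]
    rw [mul_assoc, barD_mul, hw, barD_mul, map_mul (wordSign k M), wordSign_ι, neg_mul, map_neg,
      sub_mul, mul_sub]
    linear_combination (norm := (simp only [mul_assoc]; abel)) key

/-- Insertion of the letter `x`, with sign:
`insertLetter x (y₁ ⊗ ⋯ ⊗ yₘ) = ∑_{0 ≤ j < m} (-1)^j y₁ ⊗ ⋯ ⊗ yⱼ ⊗ x ⊗ yⱼ₊₁ ⊗ ⋯ ⊗ yₘ`. -/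
def insertLetter (x : M) : TensorAlgebra k M →ₗ[k] TensorAlgebra k M :=
  wordRec 0 (LinearMap.mk₂ k
    (fun y p => ι k x * (ι k y * p.1) - ι k y * p.2)
    (fun y y' p => by simp [add_mul, mul_add]; abel) (fun c y p => by simp [smul_sub])
    (fun y p p' => by simp [mul_add]; abel) (fun c y p => by simp [smul_sub]))

@[simp] theorem insertLetter_one (x : M) : insertLetter k x 1 = 0 := by simp [insertLetter]

@[simp] theorem insertLetter_mul (x y : M) (w : TensorAlgebra k M) :
    insertLetter k x (ι k y * w) = ι k x * (ι k y * w) - ι k y * insertLetter k x w := by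
  simp [insertLetter]

@[simp] theorem insertLetter_ι (x y : M) : insertLetter k x (ι k y) = ι k x * ι k y := by
  simpa using insertLetter_mul k x y 1

/-- The adjoint action of `x` on words, by derivations. -/
def adWord (x : M) : TensorAlgebra k M →ₗ[k] TensorAlgebra k M :=
  wordRec 0 (LinearMap.mk₂ k
    (fun y p => ι k ⁅x, y⁆ * p.1 + ι k y * p.2)
    (fun y y' p => by
      simp only [Ring.lie_def, mul_add, add_mul, map_add, map_sub, sub_mul]; abel)
    (fun c y p => by
      simp only [Ring.lie_def, mul_smul_comm, smul_mul_assoc, ← smul_sub, map_smul, ← smul_add])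
    (fun y p p' => by simp [mul_add]; abel) (fun c y p => by simp))

@[simp] theorem adWord_one (x : M) : adWord k x 1 = 0 := by simp [adWord]

@[simp] theorem adWord_mul (x y : M) (w : TensorAlgebra k M) :
    adWord k x (ι k y * w) = ι k ⁅x, y⁆ * w + ι k y * adWord k x w := by simp [adWord]

@[simp] theorem adWord_ι (x y : M) : adWord k x (ι k y) = ι k ⁅x, y⁆ := by
  simpa using adWord_mul k x y 1

theorem insertLetter_mul_right (x : M) (u v : TensorAlgebra k M) :
    insertLetter k x (u * v) = insertLetter k x u * v + wordSign k M u * insertLetter k x v := by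
  induction u using word_induction with
  | one => simp
  | add a b ha hb => simp [add_mul, ha, hb]; abel
  | smul c a ha => simp [ha]
  | mul y w hw => simp [mul_assoc, hw, mul_add, sub_mul]; abel

theorem adWord_mul_right (x : M) (u v : TensorAlgebra k M) :
    adWord k x (u * v) = adWord k x u * v + u * adWord k x v := by
  induction u using word_induction with
  | one => simp
  | add a b ha hb => simp [add_mul, ha, hb]; abel
  | smul c a ha => simp [ha]
  | mul y w hw => simp [mul_assoc, hw, mul_add, add_mul]; abel

theorem insertLetter_wordSign (x : M) (w : TensorAlgebra k M) :
    insertLetter k x (wordSign k M w) = -wordSign k M (insertLetter k x w) := by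
  induction w using word_induction with
  | one => simp
  | add a b ha hb => simp [ha, hb]; abel
  | smul c a ha => simp [ha]
  | mul y w hw => simp [hw]

theorem adWord_wordSign (x : M) (w : TensorAlgebra k M) :
    adWord k x (wordSign k M w) = wordSign k M (adWord k x w) := by
  induction w using word_induction with
  | one => simp
  | add a b ha hb => simp [ha, hb]
  | smul c a ha => simp [ha]
  | mul y w hw => simp [hw]; abel

theorem barD_insertLetter (x : M) (w : TensorAlgebra k M) :
    barD k M (insertLetter k x w) + insertLetter k x (barD k M w) =
      adWord k x w + tailMul k x w := by
  induction w using word_induction with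
  | one => simp
  | add a b ha hb =>
    simp only [map_add]; rw [add_add_add_comm, ha, hb]; abel
  | smul c a ha => simp only [map_smul, ← smul_add, ha]
  | mul y w hw =>
    have key : ι k (x * y) * w - ι k x * headMul k w y - headMul k (insertLetter k x w) y
        + insertLetter k x (headMul k w y) + ι k y * tailMul k x w
        = ι k ⁅x, y⁆ * w + tailMul k x (ι k y * w) := by
      clear hw
      induction w using word_cases_left with
      | one => simp [Ring.lie_def]
      | add a b ha hb =>
        simp only [map_add, LinearMap.add_apply, mul_add] at *
        linear_combination (norm := abel) ha + hb
      | smul c a ha =>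
        simp only [map_smul, LinearMap.smul_apply, mul_smul_comm, ← smul_add, ← smul_sub, ha]
      | mul a w =>
        rw [tailMul_ι_mul]; simp [Ring.lie_def, sub_mul]; abel
    have hw' := congrArg (ι k y * ·) hw
    simp only [mul_add] at hw'
    simp only [insertLetter_mul, barD_mul, map_sub, headMul_mul, adWord_mul, mul_sub]
    linear_combination (norm := abel) key + hw'

theorem headMul_headMul (x y : M) (w : TensorAlgebra k M) :
    headMul k (headMul k w y) x = headMul k w (x * y) := by
  induction w using word_cases_left with
  | one => simp
  | add a b ha hb => simp_all
  | smul c a ha => simp_all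
  | mul a w => simp [mul_assoc]

theorem tailMul_tailMul (x y : M) (w : TensorAlgebra k M) :
    tailMul k x (tailMul k y w) = tailMul k (y * x) w := by
  induction w using word_cases_right with
  | one => simp
  | add a b ha hb => simp_all
  | smul c a ha => simp_all
  | mul a w => simp [mul_assoc]

theorem barD_headMul (y : M) (w : TensorAlgebra k M) :
    barD k M (headMul k w y) = headMul k (barD k M w) y := by
  induction w using word_cases_left with
  | one => simp
  | add a b ha hb => simp_all
  | smul c a ha => simp_all
  | mul a w => simp [headMul_headMul]

theorem barD_barD (w : TensorAlgebra k M) : barD k M (barD k M w) = 0 := by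
  induction w using word_induction with
  | one => simp
  | add a b ha hb => simp [ha, hb]
  | smul c a ha => simp [ha]
  | mul y w hw => simp [hw, barD_headMul]

/-! ### Descent to the Connes complex -/

/-- `x w ↦ ±(xₙ x) ⊗ ⋯` agrees up to rotation with multiplication of the last letter. -/
theorem cyc_lastFace (x : M) (w : TensorAlgebra k M) :
    cyc k (lastFace k M (ι k x * w)) = -cyc k (tailMul k x w) := by
  induction w using word_cases_right with
  | one => simp
  | add a b ha hb => simp only [mul_add, map_add, ha, hb, neg_add]
  | smul c a ha => simp only [mul_smul_comm, map_smul, ha, smul_neg]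
  | mul a w =>
    rw [← mul_assoc, lastFace_mul, tailMul_mul, map_mul (wordSign k M), wordSign_ι, neg_mul,
      map_neg, LinearMap.neg_apply, headMul_mul, map_neg, cyc_rotate, wordSign_wordSign]

theorem cyc_hochschildD (x : M) (w : TensorAlgebra k M) :
    cyc k (hochschildD k M (ι k x * w)) =
      cyc k (headMul k w x - ι k x * barD k M w - tailMul k x w) := by
  rw [hochschildD, LinearMap.add_apply, map_add, cyc_lastFace, barD_mul, map_sub _ _ (tailMul k x w)]
  abel

theorem hochschildD_mul_ι (x : M) (w : TensorAlgebra k M) :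
    hochschildD k M (w * ι k x) =
      barD k M w * ι k x - tailMul k x (wordSign k M w) + headMul k (wordSign k M w) x := by
  rw [hochschildD, LinearMap.add_apply, lastFace_mul, barD_mul_right]

variable (M) in
/-- The differential of the Connes complex, induced by the Hochschild differential. -/
def connesD : Connes k M →ₗ[k] Connes k M :=
  connesLift k ((cyc k).comp (hochschildD k M)) (by simp [hochschildD]) (fun x w => by
    rw [LinearMap.comp_apply, LinearMap.comp_apply, cyc_hochschildD, hochschildD_mul_ι,
      wordSign_wordSign, barD_wordSign, map_sub, map_sub, cyc_rotate k x (barD k M w), map_add,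
      map_sub, neg_mul, map_neg]
    abel)

variable (M) in
/-- The sign `(-1)^n` on words of length `n`, on the Connes complex. -/
def connesSign : Connes k M →ₗ[k] Connes k M :=
  connesLift k ((cyc k).comp (wordSign k M).toLinearMap) (by simp) (fun x w => by
    simp only [LinearMap.comp_apply, AlgHom.toLinearMap_apply, map_mul, wordSign_ι,
      wordSign_wordSign, neg_mul, mul_neg, map_neg, cyc_rotate])

theorem cyc_insertLetter_rotate (x y : M) (w : TensorAlgebra k M) :
    cyc k (insertLetter k x (ι k y * w)) = cyc k (insertLetter k x (wordSign k M w * ι k y)) := by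
  rw [insertLetter_mul, insertLetter_mul_right, wordSign_wordSign, insertLetter_ι,
    insertLetter_wordSign, map_sub, map_add, cyc_rotate k x, cyc_rotate k y (insertLetter k x w),
    map_mul (wordSign k M), wordSign_ι, neg_mul, neg_mul, map_neg, mul_assoc, cyc_rotate k y,
    map_mul (wordSign k M), wordSign_ι, wordSign_wordSign, neg_mul, map_neg, mul_neg, neg_mul,
    map_neg, mul_assoc]
  abel

/-- Signed insertion of a letter at all places of a cyclic word. -/
def connesInsert (x : M) : Connes k M →ₗ[k] Connes k M :=
  connesLift k ((cyc k).comp (insertLetter k x)) (by simp) (fun y w =>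
    cyc_insertLetter_rotate k x y w)

/-- The adjoint action of a letter on cyclic words. -/
def connesAd (x : M) : Connes k M →ₗ[k] Connes k M :=
  connesLift k ((cyc k).comp (adWord k x)) (by simp) (fun y w => by
    rw [LinearMap.comp_apply, LinearMap.comp_apply, adWord_mul, adWord_mul_right, adWord_wordSign,
      adWord_ι, map_add, map_add, cyc_rotate, cyc_rotate]
    abel)

@[simp] theorem connesD_cyc (w : TensorAlgebra k M) :
    connesD k M (cyc k w) = cyc k (hochschildD k M w) := rfl

@[simp] theorem connesSign_cyc (w : TensorAlgebra k M) :
    connesSign k M (cyc k w) = cyc k (wordSign k M w) := rfl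

@[simp] theorem connesInsert_cyc (x : M) (w : TensorAlgebra k M) :
    connesInsert k x (cyc k w) = cyc k (insertLetter k x w) := rfl

@[simp] theorem connesAd_cyc (x : M) (w : TensorAlgebra k M) :
    connesAd k x (cyc k w) = cyc k (adWord k x w) := rfl

theorem connes_induction {P : Connes k M → Prop} (h : ∀ w, P (cyc k w)) (u : Connes k M) : P u := by
  obtain ⟨w, rfl⟩ := (connesRel k M).mkQ_surjective u
  exact h w

/-- The homotopy formula: `b` and insertion of `x` anticommute to the adjoint action of `x`. -/
theorem connesD_connesInsert (x : M) (u : Connes k M) :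
    connesD k M (connesInsert k x u) + connesInsert k x (connesD k M u) = connesAd k x u := by
  induction u using connes_induction with | h w
  simp only [connesD_cyc, connesInsert_cyc, connesAd_cyc]
  have h := congrArg (cyc k) (barD_insertLetter k x w)
  suffices h' : cyc k (lastFace k M (insertLetter k x w)) +
      cyc k (insertLetter k x (lastFace k M w)) = - cyc k (tailMul k x w) by
    simp only [hochschildD, LinearMap.add_apply, map_add] at h ⊢
    linear_combination (norm := abel) h + h'
  clear h
  induction w using word_cases with
  | one => simp
  | add a b ha hb => simp only [map_add]; linear_combination (norm := abel) ha + hb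
  | smul c a ha => simp only [map_smul, ← smul_add, ha, smul_neg]
  | single y =>
    rw [lastFace_ι, insertLetter_ι, lastFace_mul, wordSign_ι]; simp
  | mul y w z =>
    have e1 : lastFace k M (insertLetter k x (ι k y * (w * ι k z))) =
        ι k (z * x) * (ι k y * wordSign k M w) + ι k (z * y) * wordSign k M (insertLetter k x w)
          - ι k (z * y) * w * ι k x := by
      rw [← mul_assoc, insertLetter_mul_right, insertLetter_mul, insertLetter_ι, ← mul_assoc,
        map_add, lastFace_mul, ← mul_assoc (wordSign k M _), lastFace_mul]
      simp [mul_assoc]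
      abel
    have e2 : insertLetter k x (lastFace k M (ι k y * (w * ι k z))) =
        -(ι k x * (ι k (z * y) * wordSign k M w))
          - ι k (z * y) * wordSign k M (insertLetter k x w) := by
      rw [← mul_assoc, lastFace_mul]
      simp [insertLetter_wordSign]
      abel
    have e3 : tailMul k x (ι k y * (w * ι k z)) = ι k y * w * ι k (z * x) := by
      rw [← mul_assoc, tailMul_mul]
    have e4 := cyc_rotate k x (ι k (z * y) * wordSign k M w)
    have e5 := cyc_rotate k (z * x) (ι k y * wordSign k M w)
    simp only [map_mul, wordSign_ι, wordSign_wordSign, neg_mul, map_neg] at e4 e5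
    rw [e1, e2, e3]
    simp only [map_add, map_sub, map_neg]
    linear_combination (norm := abel) e5 - e4

theorem connesD_connesD (u : Connes k M) : connesD k M (connesD k M u) = 0 := by
  induction u using connes_induction with | h u
  simp only [connesD_cyc]
  suffices h' : cyc k (lastFace k M (barD k M u)) + cyc k (barD k M (lastFace k M u)) +
      cyc k (lastFace k M (lastFace k M u)) = 0 by
    simp only [hochschildD, LinearMap.add_apply, map_add, barD_barD, map_zero]
    linear_combination (norm := abel) h'
  induction u using word_cases with
  | one => simp
  | add a b ha hb => simp only [map_add]; linear_combination (norm := abel) ha + hb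
  | smul c a ha => simp only [map_smul, ← smul_add, ha, smul_zero]
  | single y => simp
  | mul y w z =>
    have e1 : lastFace k M (ι k y * (w * ι k z)) = -(ι k (z * y) * wordSign k M w) := by
      rw [← mul_assoc, lastFace_mul]; simp
    have e2 := cyc_lastFace k (z * y) (wordSign k M w)
    have e3 := cyc_lastFace k y (barD k M (w * ι k z))
    rw [barD_mul_right, map_sub, tailMul_mul, tailMul_tailMul, map_sub] at e3
    have e4 := cyc_rotate k (z * y) (barD k M (wordSign k M w))
    rw [barD_wordSign, map_neg, wordSign_wordSign, ← barD_wordSign, neg_mul, map_neg] at e4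
    have e5 : lastFace k M (headMul k (w * ι k z) y) = headMul k (wordSign k M w) (z * y) := by
      clear e1 e2 e3 e4
      induction w using word_cases_left with
      | one => simp
      | add a b ha hb => simp_all [add_mul]
      | smul c a ha => simp_all
      | mul a w =>
        rw [mul_assoc, headMul_mul, ← mul_assoc, lastFace_mul]; simp [mul_assoc]
    rw [e1]
    simp only [barD_mul, map_sub, map_neg, e5, e2, e4]
    rw [barD_mul_right, e3]
    abel

theorem insertLetter_insertLetter (x y : M) (w : TensorAlgebra k M) :
    insertLetter k x (insertLetter k y w) + insertLetter k y (insertLetter k x w) = 0 := by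
  induction w using word_induction with
  | one => simp
  | add a b ha hb => simp only [map_add]; linear_combination (norm := abel) ha + hb
  | smul c a ha => simp only [map_smul, ← smul_add, ha, smul_zero]
  | mul z w hw =>
    have := congrArg (ι k z * ·) hw
    simp only [mul_add, mul_zero] at this
    simp only [insertLetter_mul, map_sub, mul_sub]
    linear_combination (norm := abel) this

theorem adWord_insertLetter (x y : M) (w : TensorAlgebra k M) :
    adWord k x (insertLetter k y w) - insertLetter k y (adWord k x w) =
      insertLetter k ⁅x, y⁆ w := by
  induction w using word_induction with
  | one => simp
  | add a b ha hb => simp only [map_add]; linear_combination (norm := abel) ha + hb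
  | smul c a ha => simp only [map_smul, ← smul_sub, ha]
  | mul z w hw =>
    have := congrArg (ι k z * ·) hw
    simp only [mul_sub] at this
    simp only [insertLetter_mul, adWord_mul, map_sub, map_add, mul_add]
    linear_combination (norm := abel) -this

theorem connesInsert_connesInsert (x y : M) (u : Connes k M) :
    connesInsert k x (connesInsert k y u) + connesInsert k y (connesInsert k x u) = 0 := by
  induction u using connes_induction with | h u
  simp only [connesInsert_cyc, ← map_add, insertLetter_insertLetter, map_zero]

theorem connesAd_connesInsert (x y : M) (u : Connes k M) :
    connesAd k x (connesInsert k y u) - connesInsert k y (connesAd k x u) =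
      connesInsert k ⁅x, y⁆ u := by
  induction u using connes_induction with | h u
  simp only [connesInsert_cyc, connesAd_cyc, ← map_sub, adWord_insertLetter]

theorem insertLetter_add (x y : M) (w : TensorAlgebra k M) :
    insertLetter k (x + y) w = insertLetter k x w + insertLetter k y w := by
  induction w using word_induction with
  | one => simp
  | add a b ha hb => simp only [map_add]; linear_combination (norm := abel) ha + hb
  | smul c a ha => simp only [map_smul, ← smul_add, ha]
  | mul z w hw => simp only [insertLetter_mul, hw, map_add, add_mul, mul_add]; abel

theorem insertLetter_smul (c : k) (y : M) (w : TensorAlgebra k M) :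
    insertLetter k (c • y) w = c • insertLetter k y w := by
  induction w using word_induction with
  | one => simp
  | add a b ha hb => simp only [map_add, ha, hb, smul_add]
  | smul d a ha => rw [map_smul, ha, map_smul, smul_comm]
  | mul z w hw => simp only [insertLetter_mul, hw, map_smul, smul_mul_assoc, mul_smul_comm, smul_sub]

theorem connesInsert_add (x y : M) : connesInsert k (x + y) = connesInsert k x + connesInsert k y := by
  refine LinearMap.ext fun u => ?_
  induction u using connes_induction with | h u
  simp [insertLetter_add]

theorem connesInsert_smul (c : k) (y : M) : connesInsert k (c • y) = c • connesInsert k y := by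
  refine LinearMap.ext fun u => ?_
  induction u using connes_induction with | h u
  simp [insertLetter_smul]

/-! ### Degrees -/

theorem insertLetter_mem (x : M) {n : ℕ} {w : TensorAlgebra k M} (hw : w ∈ wordDeg k M n) :
    insertLetter k x w ∈ wordDeg k M (n + 1) := by
  refine wordDeg_induction (P := fun n w => insertLetter k x w ∈ wordDeg k M (n + 1))
    ?_ ?_ ?_ ?_ hw
  · simp
  · intro n a b ha hb; rw [map_add]; exact add_mem ha hb
  · intro n c a ha; rw [map_smul]; exact Submodule.smul_mem _ _ ha
  · intro n y w hw h
    rw [insertLetter_mul]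
    exact sub_mem (ι_mul_mem_wordDeg _ (ι_mul_mem_wordDeg _ hw)) (ι_mul_mem_wordDeg _ h)

theorem adWord_mem (x : M) {n : ℕ} {w : TensorAlgebra k M} (hw : w ∈ wordDeg k M n) :
    adWord k x w ∈ wordDeg k M n := by
  refine wordDeg_induction (P := fun n w => adWord k x w ∈ wordDeg k M n)
    ?_ ?_ ?_ ?_ hw
  · simp
  · intro n a b ha hb; rw [map_add]; exact add_mem ha hb
  · intro n c a ha; rw [map_smul]; exact Submodule.smul_mem _ _ ha
  · intro n y w hw h
    rw [adWord_mul]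
    exact add_mem (ι_mul_mem_wordDeg _ hw) (ι_mul_mem_wordDeg _ h)

theorem wordSign_mem {n : ℕ} {w : TensorAlgebra k M} (hw : w ∈ wordDeg k M n) :
    wordSign k M w ∈ wordDeg k M n := by
  rw [wordSign_of_mem hw]; exact Submodule.smul_mem _ _ hw

theorem headMul_mem (x : M) {n : ℕ} {w : TensorAlgebra k M} (hw : w ∈ wordDeg k M n) :
    headMul k w x ∈ wordDeg k M n := by
  refine wordDeg_induction (P := fun n w => headMul k w x ∈ wordDeg k M n)
    ?_ ?_ ?_ ?_ hw
  · simp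
  · intro n a b ha hb; rw [map_add]; exact add_mem ha hb
  · intro n c a ha; rw [map_smul]; exact Submodule.smul_mem _ _ ha
  · intro n y w hw h
    rw [headMul_mul]
    exact ι_mul_mem_wordDeg _ hw

theorem barD_mem {n : ℕ} {w : TensorAlgebra k M} (hw : w ∈ wordDeg k M n) :
    barD k M w ∈ wordDeg k M (n - 1) := by
  refine wordDeg_induction (P := fun n w => barD k M w ∈ wordDeg k M (n - 1))
    ?_ ?_ ?_ ?_ hw
  · simp
  · intro n a b ha hb; rw [map_add]; exact add_mem ha hb
  · intro n c a ha; rw [map_smul]; exact Submodule.smul_mem _ _ ha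
  · intro n y w hw h
    rw [barD_mul]
    refine sub_mem (headMul_mem k _ hw) ?_
    cases n with
    | zero =>
      obtain ⟨c, rfl⟩ := Submodule.mem_one.1 (by simpa [wordDeg] using hw)
      simp [Algebra.algebraMap_eq_smul_one]
    | succ n => exact ι_mul_mem_wordDeg _ h

theorem lastFace_mem {n : ℕ} {w : TensorAlgebra k M} (hw : w ∈ wordDeg k M n) :
    lastFace k M w ∈ wordDeg k M (n - 1) := by
  refine wordDeg_induction_right (P := fun n w => lastFace k M w ∈ wordDeg k M (n - 1))
    ?_ ?_ ?_ ?_ hw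
  · simp
  · intro n a b ha hb; rw [map_add]; exact add_mem ha hb
  · intro n c a ha; rw [map_smul]; exact Submodule.smul_mem _ _ ha
  · intro n y w hw _
    rw [lastFace_mul]
    exact headMul_mem k _ (wordSign_mem k hw)

theorem connesDeg_zero : connesDeg k M 0 = ⊥ := by
  rw [eq_bot_iff]
  rintro _ ⟨w, hw, rfl⟩
  obtain ⟨c, rfl⟩ := Submodule.mem_one.1 (by simpa [wordDeg] using hw)
  simp [Algebra.algebraMap_eq_smul_one]

theorem connesD_mem {n : ℕ} {u : Connes k M} (hu : u ∈ connesDeg k M n) :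
    connesD k M u ∈ connesDeg k M (n - 1) := by
  obtain ⟨w, hw, rfl⟩ := hu
  exact ⟨_, add_mem (barD_mem k hw) (lastFace_mem k hw), rfl⟩

theorem connesInsert_mem (x : M) {n : ℕ} {u : Connes k M} (hu : u ∈ connesDeg k M n) :
    connesInsert k x u ∈ connesDeg k M (n + 1) := by
  obtain ⟨w, hw, rfl⟩ := hu
  exact ⟨_, insertLetter_mem k x hw, rfl⟩

theorem connesAd_mem (x : M) {n : ℕ} {u : Connes k M} (hu : u ∈ connesDeg k M n) :
    connesAd k x u ∈ connesDeg k M n := by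
  obtain ⟨w, hw, rfl⟩ := hu
  exact ⟨_, adWord_mem k x hw, rfl⟩

theorem connesSign_of_mem {n : ℕ} {u : Connes k M} (hu : u ∈ connesDeg k M n) :
    connesSign k M u = (-1 : k) ^ n • u := by
  obtain ⟨w, hw, rfl⟩ := hu
  rw [connesSign_cyc, wordSign_of_mem hw, map_smul]

theorem cyc_mem {n : ℕ} {w : TensorAlgebra k M} (hw : w ∈ wordDeg k M n) :
    cyc k w ∈ connesDeg k M n := ⟨w, hw, rfl⟩

theorem iSup_wordDeg (w : TensorAlgebra k M) : w ∈ ⨆ n, wordDeg k M n := by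
  induction w using word_induction with
  | one => exact Submodule.mem_iSup_of_mem 0 one_mem_wordDeg
  | add a b ha hb => exact add_mem ha hb
  | smul c a ha => exact Submodule.smul_mem _ _ ha
  | mul x w hw =>
    induction hw using Submodule.iSup_induction' with
    | mem i v hv => exact Submodule.mem_iSup_of_mem (i + 1) (ι_mul_mem_wordDeg x hv)
    | zero => simp
    | add a b _ _ ha hb => rw [mul_add]; exact add_mem ha hb

variable {k} in
/-- The Connes complex is spanned by homogeneous elements. -/
theorem connes_hom_induction {P : Connes k M → Prop} (zero : P 0)
    (add : ∀ a b, P a → P b → P (a + b)) (h : ∀ n, ∀ u ∈ connesDeg k M n, P u) (u : Connes k M) :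
    P u := by
  induction u using connes_induction with | h u
  induction iSup_wordDeg k u using Submodule.iSup_induction' with
  | mem i v hv => exact h i _ (cyc_mem k hv)
  | zero => simpa using zero
  | add a b _ _ ha hb => rw [map_add]; exact add _ _ ha hb

end Connes

section ConnesSym

variable (k : Type*) (M : Type*) [CommRing k] [Ring M] [Algebra k M]

/-- Graded commutativity: `u v ∼ (-1)^{pq} v u` for `u`, `v` of degrees `p`, `q` in `C^λ(M)[1]`. -/
inductive ConnesSym.Rel : TensorAlgebra k (Connes k M) → TensorAlgebra k (Connes k M) → Prop
  | comm (p q : ℕ) (u v : Connes k M) (hu : u ∈ connesDeg k M p) (hv : v ∈ connesDeg k M q) :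
    ConnesSym.Rel (ι k u * ι k v) ((-1 : k) ^ (p * q) • (ι k v * ι k u))

/-- The symmetric algebra `Sym(C^λ(M)[1])` of the graded module `C^λ(M)[1]`: the quotient of its
tensor algebra by the relations of graded commutativity. -/
def ConnesSym : Type _ := (ringConGen (ConnesSym.Rel k M)).Quotient

instance : Ring (ConnesSym k M) := inferInstanceAs (Ring (RingCon.Quotient _))

instance : Algebra k (ConnesSym k M) := inferInstanceAs (Algebra k (RingCon.Quotient _))

/-- The projection from the tensor algebra. -/
def symMk : TensorAlgebra k (Connes k M) →ₐ[k] ConnesSym k M :=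
  RingCon.mkₐ k (ringConGen (ConnesSym.Rel k M))

theorem symMk_surjective : Function.Surjective (symMk k M) := Quotient.mk_surjective

variable {M}

/-- The inclusion of generators `C^λ(M)[1] → Sym(C^λ(M)[1])`. -/
def symι : Connes k M →ₗ[k] ConnesSym k M :=
  (symMk k M).toLinearMap.comp (ι k)

theorem symι_comm {p q : ℕ} {u v : Connes k M} (hu : u ∈ connesDeg k M p)
    (hv : v ∈ connesDeg k M q) :
    symι k u * symι k v = (-1 : k) ^ (p * q) • (symι k v * symι k u) := by
  have h : symMk k M (ι k u * ι k v) = symMk k M ((-1 : k) ^ (p * q) • (ι k v * ι k u)) :=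
    Quotient.sound (RingCon.le_ringConGen _ _ (ConnesSym.Rel.comm p q u v hu hv))
  rw [map_smul, map_mul, map_mul] at h
  exact h

/-- The universal property of `Sym(C^λ(M)[1])`. -/
def symLift {B : Type*} [Ring B] [Algebra k B] (f : Connes k M →ₗ[k] B)
    (h : ∀ p q u v, u ∈ connesDeg k M p → v ∈ connesDeg k M q →
      f u * f v = (-1 : k) ^ (p * q) • (f v * f u)) : ConnesSym k M →ₐ[k] B :=
  RingCon.liftₐ _ (TensorAlgebra.lift k f) (RingCon.ringConGen_le.2 (by
    rintro _ _ ⟨p, q, u, v, hu, hv⟩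
    simpa [RingCon.ker_apply] using h p q u v hu hv))

@[simp] theorem symLift_symι {B : Type*} [Ring B] [Algebra k B] (f : Connes k M →ₗ[k] B)
    (h : ∀ p q u v, u ∈ connesDeg k M p → v ∈ connesDeg k M q →
      f u * f v = (-1 : k) ^ (p * q) • (f v * f u)) (u : Connes k M) :
    symLift k f h (symι k u) = f u := by
  exact (RingCon.liftₐ_mk _ _ _ _).trans (TensorAlgebra.lift_ι_apply f u)

variable {k} in
theorem sym_induction {P : ConnesSym k M → Prop} (one : P 1)
    (add : ∀ a b, P a → P b → P (a + b)) (smul : ∀ (c : k) a, P a → P (c • a))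
    (mul : ∀ u s, P s → P (symι k u * s)) (s : ConnesSym k M) : P s := by
  obtain ⟨t, rfl⟩ := symMk_surjective k M s
  induction t using word_induction with
  | one => simpa using one
  | add a b ha hb => rw [map_add]; exact add _ _ ha hb
  | smul c a ha => rw [map_smul]; exact smul _ _ ha
  | mul u t ht => rw [map_mul]; exact mul u _ ht

variable (M) in
/-- The degree `n` part of `Sym(C^λ(M)[1])`: it is spanned by the products `u₁ ⋯ uₘ` with `uᵢ` of
degree `pᵢ` in `C^λ(M)[1]` and `p₁ + ⋯ + pₘ = n`. -/
def symDeg (n : ℕ) : Submodule k (ConnesSym k M) :=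
  Submodule.span k {s | ∃ l : List (ℕ × Connes k M), (∀ a ∈ l, a.2 ∈ connesDeg k M a.1) ∧
    (l.map Prod.fst).sum = n ∧ s = (l.map fun a => symι k a.2).prod}

theorem one_mem_symDeg : (1 : ConnesSym k M) ∈ symDeg k M 0 :=
  Submodule.subset_span ⟨[], by simp⟩

theorem symι_mul_mem_symDeg {p n : ℕ} {u : Connes k M} {s : ConnesSym k M}
    (hu : u ∈ connesDeg k M p) (hs : s ∈ symDeg k M n) : symι k u * s ∈ symDeg k M (p + n) := by
  induction hs using Submodule.span_induction with
  | mem s hs =>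
    obtain ⟨l, hl, rfl, rfl⟩ := hs
    exact Submodule.subset_span ⟨(p, u) :: l, by simpa using ⟨hu, fun a b h => hl _ h⟩, by simp⟩
  | zero => simp
  | add a b _ _ ha hb => rw [mul_add]; exact add_mem ha hb
  | smul c a _ ha => rw [mul_smul_comm]; exact Submodule.smul_mem _ _ ha

variable {k} in
theorem symDeg_induction {P : ℕ → ConnesSym k M → Prop} (one : P 0 1) (zero : ∀ n, P n 0)
    (add : ∀ n a b, P n a → P n b → P n (a + b)) (smul : ∀ n (c : k) a, P n a → P n (c • a))
    (mul : ∀ p n u s, u ∈ connesDeg k M p → s ∈ symDeg k M n → P n s → P (p + n) (symι k u * s))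
    {n : ℕ} {s : ConnesSym k M} (hs : s ∈ symDeg k M n) : P n s := by
  induction hs using Submodule.span_induction with
  | mem s hs =>
    obtain ⟨l, hl, rfl, rfl⟩ := hs
    induction l with
    | nil => simpa using one
    | cons a l ih =>
      simp only [List.map_cons, List.sum_cons, List.prod_cons]
      refine mul _ _ _ _ (hl a (by simp)) (Submodule.subset_span ⟨l, ?_, rfl, rfl⟩) (ih ?_)
      all_goals exact fun b hb => hl b (by simp [hb])
  | zero => exact zero n
  | add a b _ _ ha hb => exact add _ _ _ ha hb
  | smul c a _ ha => exact smul _ _ _ ha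

/-- Auxiliary to `symDer`. -/
def symDerAux (σ : Connes k M →ₗ[k] Connes k M) (δ : Connes k M →ₗ[k] Connes k M) :
    Connes k M →ₗ[k] Module.End k (ConnesSym k M × ConnesSym k M) :=
  { toFun := fun u =>
      ((LinearMap.mulLeft k (symι k u)).comp (LinearMap.fst k _ _)).prod
        ((LinearMap.mulLeft k (symι k (δ u))).comp (LinearMap.fst k _ _) +
          (LinearMap.mulLeft k (symι k (σ u))).comp (LinearMap.snd k _ _))
    map_add' := fun x y => by ext <;> simp [add_mul]
    map_smul' := fun c x => by ext <;> simp }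

@[simp] theorem symDerAux_apply (σ : Connes k M →ₗ[k] Connes k M) (δ : Connes k M →ₗ[k] Connes k M)
    (u : Connes k M) (s t : ConnesSym k M) :
    symDerAux k σ δ u (s, t) = (symι k u * s, symι k (δ u) * s + symι k (σ u) * t) := by
  simp [symDerAux]

/-- `δ` is a linear endomorphism of `C^λ(M)[1]` of parity `a`. -/
structure HasParity (a : ℕ) (σ δ : Connes k M →ₗ[k] Connes k M) : Prop where
  sign : ∀ p, ∀ u ∈ connesDeg k M p, σ u = (-1 : k) ^ (a * p) • u
  parity : ∀ p, ∀ u ∈ connesDeg k M p, ∃ q, (-1 : k) ^ q = (-1 : k) ^ (p + a) ∧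
    δ u ∈ connesDeg k M q

theorem symDerAux_comm {a : ℕ} {σ δ : Connes k M →ₗ[k] Connes k M} (h : HasParity k a σ δ)
    (p q : ℕ) (u v : Connes k M) (hu : u ∈ connesDeg k M p) (hv : v ∈ connesDeg k M q) :
    symDerAux k σ δ u * symDerAux k σ δ v =
      (-1 : k) ^ (p * q) • (symDerAux k σ δ v * symDerAux k σ δ u) := by
  refine LinearMap.ext fun ⟨s, t⟩ => ?_
  obtain ⟨p', hp', hu'⟩ := h.parity p u hu
  obtain ⟨q', hq', hv'⟩ := h.parity q v hv
  have e1 := symι_comm k hu hv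
  have e2 := symι_comm k hu' hv
  have e3 := symι_comm k hu hv'
  rw [pow_mul, hp', ← pow_mul] at e2
  rw [mul_comm p q', pow_mul, hq', ← pow_mul] at e3
  have s1 : (-1 : k) ^ (a * p) * (-1 : k) ^ ((q + a) * p) = (-1 : k) ^ (p * q) := by
    rw [← pow_add, show a * p + (q + a) * p = p * q + 2 * (a * p) by ring, pow_add, pow_mul _ 2]
    simp
  have s2 : (-1 : k) ^ ((p + a) * q) = (-1 : k) ^ (p * q) * (-1 : k) ^ (a * q) := by
    rw [← pow_add]; ring_nf
  simp only [Module.End.mul_apply, symDerAux_apply, LinearMap.smul_apply, h.sign p u hu,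
    h.sign q v hv, map_smul, smul_mul_assoc, mul_smul_comm, mul_add, ← mul_assoc, e1, e2, e3,
    Prod.smul_mk, smul_add, smul_smul, s1, s2, Prod.mk.injEq, true_and]
  rw [show (-1 : k) ^ (a * q) * (-1) ^ (a * p) * (-1) ^ (p * q) =
    (-1) ^ (p * q) * (-1) ^ (a * p) * (-1) ^ (a * q) by ring]
  abel

/-- Auxiliary to `symDer`. -/
def symDerHom {a : ℕ} {σ δ : Connes k M →ₗ[k] Connes k M} (h : HasParity k a σ δ) :
    ConnesSym k M →ₐ[k] Module.End k (ConnesSym k M × ConnesSym k M) :=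
  symLift k (symDerAux k σ δ) (symDerAux_comm k h)

/-- The extension of an endomorphism `δ` of `C^λ(M)[1]` of parity `a` to a graded derivation `D` of
`Sym(C^λ(M)[1])`: `D 1 = 0` and `D (u s) = δ(u) s + (-1)^{a |u|} u D(s)`. Here `σ` is
multiplication by `(-1)^{a |u|}`. -/
def symDer {a : ℕ} {σ δ : Connes k M →ₗ[k] Connes k M} (h : HasParity k a σ δ) :
    ConnesSym k M →ₗ[k] ConnesSym k M :=
  (LinearMap.snd k _ _).comp ((LinearMap.applyₗ (1, 0)).comp (symDerHom k h).toLinearMap)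

section

variable {a : ℕ} {σ δ : Connes k M →ₗ[k] Connes k M} (h : HasParity k a σ δ)

theorem symDerHom_apply (s : ConnesSym k M) : symDerHom k h s (1, 0) = (s, symDer k h s) := by
  refine Prod.ext ?_ rfl
  induction s using sym_induction with
  | one => simp
  | add a b ha hb => simp_all
  | smul c a ha => simp_all
  | mul u s hs => 
    have e : symDerHom k h (symι k u) = symDerAux k σ δ u := by simp [symDerHom]
    rw [map_mul, Module.End.mul_apply, e, ← Prod.mk.eta (p := (symDerHom k h s) (1, 0)),
      symDerAux_apply, hs]

@[simp] theorem symDer_one : symDer k h 1 = 0 := by simp [symDer]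

@[simp] theorem symDer_mul (u : Connes k M) (s : ConnesSym k M) :
    symDer k h (symι k u * s) = symι k (δ u) * s + symι k (σ u) * symDer k h s := by
  have e : symDerHom k h (symι k u) = symDerAux k σ δ u := by simp [symDerHom]
  change (symDerHom k h (symι k u * s) (1, 0)).2 = _
  rw [map_mul, Module.End.mul_apply, symDerHom_apply, e, symDerAux_apply]

@[simp] theorem symDer_symι (u : Connes k M) : symDer k h (symι k u) = symι k (δ u) := by
  simpa using symDer_mul k h u 1

end

theorem hasParity_connesD : HasParity k 1 (connesSign k M) (connesD k M) where
  sign p u hu := by rw [connesSign_of_mem k hu, one_mul]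
  parity p u hu := by
    cases p with
    | zero =>
      rw [connesDeg_zero, Submodule.mem_bot] at hu
      subst hu
      exact ⟨1, by simp⟩
    | succ p => exact ⟨p, by simp [pow_add], by simpa using connesD_mem k hu⟩

theorem hasParity_connesInsert (x : M) : HasParity k 1 (connesSign k M) (connesInsert k x) where
  sign p u hu := by rw [connesSign_of_mem k hu, one_mul]
  parity p u hu := ⟨p + 1, rfl, connesInsert_mem k x hu⟩

theorem hasParity_connesAd (x : M) : HasParity k 0 LinearMap.id (connesAd k x) where
  sign p u hu := by simp
  parity p u hu := ⟨p, rfl, connesAd_mem k x hu⟩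

variable (M) in
/-- The differential of `Sym(C^λ(M)[1])`: the derivation extending the differential of the
Connes complex. -/
def symD : ConnesSym k M →ₗ[k] ConnesSym k M := symDer k (hasParity_connesD k (M := M))

/-- The odd derivation of `Sym(C^λ(M)[1])` extending the insertion of the letter `x`. -/
def symInsert (x : M) : ConnesSym k M →ₗ[k] ConnesSym k M := symDer k (hasParity_connesInsert k x)

/-- The derivation of `Sym(C^λ(M)[1])` extending the adjoint action of `x`. -/
def symAd (x : M) : ConnesSym k M →ₗ[k] ConnesSym k M := symDer k (hasParity_connesAd k x)

section

@[simp] theorem symD_one : symD k M 1 = 0 := symDer_one _ _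
@[simp] theorem symD_mul (u : Connes k M) (s : ConnesSym k M) : symD k M (symι k u * s) =
    symι k (connesD k M u) * s + symι k (connesSign k M u) * symD k M s := symDer_mul _ _ _ _
@[simp] theorem symInsert_one (x : M) : symInsert k x 1 = 0 := symDer_one _ _
@[simp] theorem symInsert_mul (x : M) (u : Connes k M) (s : ConnesSym k M) :
    symInsert k x (symι k u * s) =
      symι k (connesInsert k x u) * s + symι k (connesSign k M u) * symInsert k x s :=
  symDer_mul _ _ _ _
@[simp] theorem symAd_one (x : M) : symAd k x 1 = 0 := symDer_one _ _
@[simp] theorem symAd_mul (x : M) (u : Connes k M) (s : ConnesSym k M) :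
    symAd k x (symι k u * s) = symι k (connesAd k x u) * s + symι k u * symAd k x s :=
  symDer_mul _ _ _ _

end

theorem connesSign_connesD (u : Connes k M) :
    connesSign k M (connesD k M u) = -connesD k M (connesSign k M u) := by
  induction u using connes_hom_induction with
  | zero => simp
  | add a b ha hb => simp only [map_add, ha, hb, neg_add]
  | h n u hu =>
    cases n with
    | zero => 
      rw [connesDeg_zero, Submodule.mem_bot] at hu
      simp [hu]
    | succ n =>
      have h2 : connesD k M u ∈ connesDeg k M n := by simpa using connesD_mem k hu
      rw [connesSign_of_mem k hu, connesSign_of_mem k h2, map_smul, pow_succ]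
      simp

theorem connesSign_connesInsert (x : M) (u : Connes k M) :
    connesSign k M (connesInsert k x u) = -connesInsert k x (connesSign k M u) := by
  induction u using connes_induction with | h u
  simp [insertLetter_wordSign]

theorem connesSign_connesAd (x : M) (u : Connes k M) :
    connesSign k M (connesAd k x u) = connesAd k x (connesSign k M u) := by
  induction u using connes_induction with | h u
  simp [adWord_wordSign]

@[simp] theorem connesSign_connesSign (u : Connes k M) :
    connesSign k M (connesSign k M u) = u := by
  induction u using connes_induction with | h u
  simp

theorem symD_symD (s : ConnesSym k M) : symD k M (symD k M s) = 0 := by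
  induction s using sym_induction with
  | one => simp
  | add a b ha hb => simp [ha, hb]
  | smul c a ha => simp [ha]
  | mul u s hs => simp [hs, connesSign_connesD, connesD_connesD]

theorem symD_symInsert (x : M) (s : ConnesSym k M) :
    symD k M (symInsert k x s) + symInsert k x (symD k M s) = symAd k x s := by
  induction s using sym_induction with
  | one => simp
  | add a b ha hb => simp only [map_add]; linear_combination (norm := abel) ha + hb
  | smul c a ha => simp only [map_smul, ← smul_add, ha]
  | mul u s hs =>
    simp only [symD_mul, symInsert_mul, symAd_mul, map_add, ← hs, ← connesD_connesInsert k x u,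
      connesSign_connesD, connesSign_connesInsert, connesSign_connesSign, map_neg, add_mul,
      neg_mul, mul_add]
    abel

theorem symInsert_symInsert (x y : M) (s : ConnesSym k M) :
    symInsert k x (symInsert k y s) + symInsert k y (symInsert k x s) = 0 := by
  induction s using sym_induction with
  | one => simp
  | add a b ha hb => simp only [map_add]; linear_combination (norm := abel) ha + hb
  | smul c a ha => simp only [map_smul, ← smul_add, ha, smul_zero]
  | mul u s hs =>
    have h1 := congrArg (symι k · * s) (connesInsert_connesInsert k x y u)
    have h2 := congrArg (symι k u * ·) hs
    simp only [map_add, add_mul, mul_add, map_zero, zero_mul, mul_zero] at h1 h2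
    simp only [symInsert_mul, map_add, connesSign_connesInsert, connesSign_connesSign, map_neg,
      neg_mul]
    linear_combination (norm := abel) h1 + h2

theorem symAd_symInsert (x y : M) (s : ConnesSym k M) :
    symAd k x (symInsert k y s) - symInsert k y (symAd k x s) = symInsert k ⁅x, y⁆ s := by
  induction s using sym_induction with
  | one => simp
  | add a b ha hb => simp only [map_add]; linear_combination (norm := abel) ha + hb
  | smul c a ha => rw [map_smul, map_smul, map_smul, map_smul, ← smul_sub, ha, map_smul]
  | mul u s hs =>
    simp only [symInsert_mul, symAd_mul, map_add, ← hs, ← connesAd_connesInsert k x y u,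
      connesSign_connesAd, map_sub, sub_mul, mul_sub]
    abel

theorem symInsert_add (x y : M) : symInsert k (x + y) = symInsert k x + symInsert k y := by
  refine LinearMap.ext fun s => ?_
  induction s using sym_induction with
  | one => simp
  | add a b ha hb => simp only [map_add, ha, hb]
  | smul c a ha => simp only [map_smul, ha]
  | mul u s hs => 
    simp only [symInsert_mul, hs, connesInsert_add, LinearMap.add_apply, map_add, add_mul, mul_add]
    abel

theorem symInsert_smul (c : k) (y : M) : symInsert k (c • y) = c • symInsert k y := by
  refine LinearMap.ext fun s => ?_
  induction s using sym_induction with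
  | one => simp
  | add a b ha hb => simp only [map_add, ha, hb]
  | smul c a ha => simp only [map_smul, ha]
  | mul u s hs => simp [symInsert_mul, hs, connesInsert_smul]

theorem symDeg_cast {m n : ℕ} {s : ConnesSym k M} (h : m = n) (hs : s ∈ symDeg k M m) :
    s ∈ symDeg k M n := h ▸ hs

theorem connesSign_mem {n : ℕ} {u : Connes k M} (hu : u ∈ connesDeg k M n) :
    connesSign k M u ∈ connesDeg k M n := by
  rw [connesSign_of_mem k hu]; exact Submodule.smul_mem _ _ hu

theorem symD_mem {n : ℕ} {s : ConnesSym k M} (hs : s ∈ symDeg k M n) :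
    symD k M s ∈ symDeg k M (n - 1) := by
  refine (symDeg_induction (P := fun n s => symD k M s ∈ symDeg k M (n - 1) ∧
    (n = 0 → symD k M s = 0)) ?_ ?_ ?_ ?_ ?_ hs).1
  · simp
  · simp
  · intro n a b ha hb
    rw [map_add]
    exact ⟨add_mem ha.1 hb.1, fun h => by rw [ha.2 h, hb.2 h, add_zero]⟩
  · intro n c a ha
    rw [map_smul]
    exact ⟨Submodule.smul_mem _ _ ha.1, fun h => by rw [ha.2 h, smul_zero]⟩
  · intro p n u s hu hs h
    rw [symD_mul]
    cases p with
    | zero =>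
      rw [connesDeg_zero, Submodule.mem_bot] at hu
      simp [hu]
    | succ p =>
      refine ⟨add_mem (symDeg_cast k (by omega) (symι_mul_mem_symDeg k (connesD_mem k hu) hs)) ?_,
        fun h => by omega⟩
      cases n with
      | zero => simp [h.2 rfl]
      | succ n =>
        exact symDeg_cast k (by omega) (symι_mul_mem_symDeg k (connesSign_mem k hu) h.1)

theorem symInsert_mem (x : M) {n : ℕ} {s : ConnesSym k M} (hs : s ∈ symDeg k M n) :
    symInsert k x s ∈ symDeg k M (n + 1) := by
  refine symDeg_induction (P := fun n s => symInsert k x s ∈ symDeg k M (n + 1)) ?_ ?_ ?_ ?_ ?_ hs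
  · simp
  · simp
  · intro n a b ha hb; rw [map_add]; exact add_mem ha hb
  · intro n c a ha; rw [map_smul]; exact Submodule.smul_mem _ _ ha
  · intro p n u s hu hs h
    rw [symInsert_mul]
    exact add_mem (symDeg_cast k (by omega) (symι_mul_mem_symDeg k (connesInsert_mem k x hu) hs))
      (symDeg_cast k (by omega) (symι_mul_mem_symDeg k (connesSign_mem k hu) h))

end ConnesSym

section Chevalley

variable (k : Type*) (L : Type*) [CommRing k] [LieRing L] [LieAlgebra k L]

/-- Anticommutativity: `x ∧ y ∼ -(y ∧ x)`. -/
inductive Chevalley.Rel : TensorAlgebra k L → TensorAlgebra k L → Prop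
  | anticomm (x y : L) : Chevalley.Rel (ι k x * ι k y) (-(ι k y * ι k x))

/-- The total module `⨁ₙ Λⁿ L` of the Chevalley complex of `L` with trivial coefficients, as an
algebra: the quotient of the tensor algebra of `L` by `x ∧ y = -(y ∧ x)`. So
`Λⁿ L = (L[1]^{⊗ n})_{Σₙ}` is the module of coinvariants of the symmetric group acting on `L^{⊗ n}`
by signed permutations, i.e. the degree `n` part of the graded symmetric algebra of `L[1]`. -/
def Chevalley : Type _ := (ringConGen (Chevalley.Rel k L)).Quotient

instance : Ring (Chevalley k L) := inferInstanceAs (Ring (RingCon.Quotient _))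

instance : Algebra k (Chevalley k L) := inferInstanceAs (Algebra k (RingCon.Quotient _))

/-- The projection from the tensor algebra. -/
def chevMk : TensorAlgebra k L →ₐ[k] Chevalley k L := RingCon.mkₐ k (ringConGen (Chevalley.Rel k L))

theorem chevMk_surjective : Function.Surjective (chevMk k L) := Quotient.mk_surjective

variable {L}

/-- The inclusion of `L` in degree `1`. -/
def chevι : L →ₗ[k] Chevalley k L := (chevMk k L).toLinearMap.comp (ι k)

theorem chevι_comm (x y : L) : chevι k x * chevι k y = -(chevι k y * chevι k x) := by
  have h : chevMk k L (ι k x * ι k y) = chevMk k L (-(ι k y * ι k x)) :=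
    Quotient.sound (RingCon.le_ringConGen _ _ (Chevalley.Rel.anticomm x y))
  rw [map_neg, map_mul, map_mul] at h
  exact h

/-- The universal property of the algebra `⨁ₙ Λⁿ L`. -/
def chevLift {B : Type*} [Ring B] [Algebra k B] (f : L →ₗ[k] B)
    (h : ∀ x y, f x * f y = -(f y * f x)) : Chevalley k L →ₐ[k] B :=
  RingCon.liftₐ _ (TensorAlgebra.lift k f) (RingCon.ringConGen_le.2 (by
    rintro _ _ ⟨x, y⟩
    simpa [RingCon.ker_apply] using h x y))

@[simp] theorem chevLift_chevι {B : Type*} [Ring B] [Algebra k B] (f : L →ₗ[k] B)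
    (h : ∀ x y, f x * f y = -(f y * f x)) (x : L) : chevLift k f h (chevι k x) = f x := by
  exact (RingCon.liftₐ_mk _ _ _ _).trans (TensorAlgebra.lift_ι_apply f x)

variable {k} in
theorem chev_induction {P : Chevalley k L → Prop} (one : P 1)
    (add : ∀ a b, P a → P b → P (a + b)) (smul : ∀ (c : k) a, P a → P (c • a))
    (mul : ∀ x s, P s → P (chevι k x * s)) (s : Chevalley k L) : P s := by
  obtain ⟨t, rfl⟩ := chevMk_surjective k L s
  induction t using word_induction with
  | one => simpa using one
  | add a b ha hb => rw [map_add]; exact add _ _ ha hb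
  | smul c a ha => rw [map_smul]; exact smul _ _ ha
  | mul u t ht => rw [map_mul]; exact mul u _ ht

variable (L) in
/-- `Λⁿ L`. -/
def chevDeg (n : ℕ) : Submodule k (Chevalley k L) := LinearMap.range (chevι k (L := L)) ^ n

/-- Auxiliary to `chevAd`. -/
def chevAdHom (x : L) : Chevalley k L →ₐ[k] Module.End k (Chevalley k L × Chevalley k L) :=
  chevLift k
    { toFun := fun y =>
        ((LinearMap.mulLeft k (chevι k y)).comp (LinearMap.fst k _ _)).prod
          ((LinearMap.mulLeft k (chevι k ⁅x, y⁆)).comp (LinearMap.fst k _ _) +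
            (LinearMap.mulLeft k (chevι k y)).comp (LinearMap.snd k _ _))
      map_add' := fun y z => by ext <;> simp [add_mul]
      map_smul' := fun c y => by ext <;> simp }
    (fun y z => by
      refine LinearMap.ext fun ⟨s, t⟩ => ?_
      simp [mul_add, ← mul_assoc, chevι_comm k y z, chevι_comm k y ⁅x, z⁆, chevι_comm k ⁅x, y⁆ z]
      abel)

/-- The adjoint action of `x` on the Chevalley complex:
`x · (y₁ ∧ ⋯ ∧ yₙ) = ∑ᵢ y₁ ∧ ⋯ ∧ [x, yᵢ] ∧ ⋯ ∧ yₙ`. -/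
def chevAd (x : L) : Chevalley k L →ₗ[k] Chevalley k L :=
  (LinearMap.snd k _ _).comp ((LinearMap.applyₗ (1, 0)).comp (chevAdHom k x).toLinearMap)

theorem chevAdHom_apply (x : L) (s : Chevalley k L) :
    chevAdHom k x s (1, 0) = (s, chevAd k x s) := by
  refine Prod.ext ?_ rfl
  induction s using chev_induction with
  | one => simp
  | add a b ha hb => simp_all
  | smul c a ha => simp_all
  | mul y s hs =>
    rw [map_mul, Module.End.mul_apply]
    simpa [chevAdHom] using congrArg (chevι k y * ·) hs

@[simp] theorem chevAd_one (x : L) : chevAd k x 1 = 0 := by simp [chevAd]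

@[simp] theorem chevAd_mul (x y : L) (s : Chevalley k L) :
    chevAd k x (chevι k y * s) = chevι k ⁅x, y⁆ * s + chevι k y * chevAd k x s := by
  change (chevAdHom k x (chevι k y * s) (1, 0)).2 = _
  rw [map_mul, Module.End.mul_apply, chevAdHom_apply]
  simp [chevAdHom]

theorem chevAd_add (x y : L) : chevAd k (x + y) = chevAd k x + chevAd k y := by
  refine LinearMap.ext fun s => ?_
  induction s using chev_induction with
  | one => simp
  | add a b ha hb => simp only [map_add, ha, hb]
  | smul c a ha => simp only [map_smul, ha]
  | mul z s hs => simp [hs, add_mul, mul_add]; abel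

theorem chevAd_smul (c : k) (x : L) : chevAd k (c • x) = c • chevAd k x := by
  refine LinearMap.ext fun s => ?_
  induction s using chev_induction with
  | one => simp
  | add a b ha hb => simp only [map_add, ha, hb]
  | smul c a ha => simp only [map_smul, ha]
  | mul z s hs => simp [hs]

theorem chevAd_lie (x y : L) (s : Chevalley k L) :
    chevAd k ⁅x, y⁆ s = chevAd k x (chevAd k y s) - chevAd k y (chevAd k x s) := by
  induction s using chev_induction with
  | one => simp
  | add a b ha hb => simp only [map_add, ha, hb]; abel
  | smul c a ha => simp only [map_smul, ha, smul_sub]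
  | mul z s hs => 
    simp only [chevAd_mul, map_add, hs, mul_sub, lie_lie, map_sub, sub_mul]; abel

/-- Auxiliary to `chevD`. -/
def chevDHom : Chevalley k L →ₐ[k] Module.End k (Chevalley k L × Chevalley k L) :=
  chevLift k
    { toFun := fun x =>
        ((LinearMap.mulLeft k (chevι k x)).comp (LinearMap.fst k _ _)).prod
          ((chevAd k x).comp (LinearMap.fst k _ _) -
            (LinearMap.mulLeft k (chevι k x)).comp (LinearMap.snd k _ _))
      map_add' := fun y z => by
        refine LinearMap.ext fun ⟨s, t⟩ => ?_
        simp [add_mul, chevAd_add]; abel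
      map_smul' := fun c y => by
        refine LinearMap.ext fun ⟨s, t⟩ => ?_
        simp [chevAd_smul, smul_sub] }
    (fun y z => by
      refine LinearMap.ext fun ⟨s, t⟩ => ?_
      have h : chevι k ⁅y, z⁆ + chevι k ⁅z, y⁆ = 0 := by
        rw [← map_add, ← lie_skew, neg_add_cancel, map_zero]
      have h' := congrArg (· * s) h
      simp only [add_mul, zero_mul] at h'
      simp [mul_sub, ← mul_assoc, chevι_comm k y z]
      linear_combination (norm := abel) h')

variable (L) in
/-- The Chevalley differential
`d (x₁ ∧ ⋯ ∧ xₙ) = ∑_{i < j} (-1)^{i+j-1} [xᵢ, xⱼ] ∧ x₁ ∧ ⋯ x̂ᵢ ⋯ x̂ⱼ ⋯ ∧ xₙ`, determined by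
`d 1 = 0` and `d (x ∧ s) = x · s - x ∧ d s`, where `x · s` is the adjoint action. -/
def chevD : Chevalley k L →ₗ[k] Chevalley k L :=
  (LinearMap.snd k _ _).comp ((LinearMap.applyₗ (1, 0)).comp (chevDHom k (L := L)).toLinearMap)

theorem chevDHom_apply (s : Chevalley k L) : chevDHom k s (1, 0) = (s, chevD k L s) := by
  refine Prod.ext ?_ rfl
  induction s using chev_induction with
  | one => simp
  | add a b ha hb => simp_all
  | smul c a ha => simp_all
  | mul y s hs =>
    rw [map_mul, Module.End.mul_apply]
    simpa [chevDHom] using congrArg (chevι k y * ·) hs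

@[simp] theorem chevD_one : chevD k L 1 = 0 := by simp [chevD]

@[simp] theorem chevD_mul (x : L) (s : Chevalley k L) :
    chevD k L (chevι k x * s) = chevAd k x s - chevι k x * chevD k L s := by
  change (chevDHom k (chevι k x * s) (1, 0)).2 = _
  rw [map_mul, Module.End.mul_apply, chevDHom_apply]
  simp [chevDHom]

theorem chevD_chevAd (x : L) (s : Chevalley k L) :
    chevD k L (chevAd k x s) = chevAd k x (chevD k L s) := by
  induction s using chev_induction with
  | one => simp
  | add a b ha hb => simp only [map_add, ha, hb]
  | smul c a ha => simp only [map_smul, ha]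
  | mul y s hs => simp [hs, chevAd_lie]; abel

theorem chevD_chevD (s : Chevalley k L) : chevD k L (chevD k L s) = 0 := by
  induction s using chev_induction with
  | one => simp
  | add a b ha hb => simp [ha, hb]
  | smul c a ha => simp [ha]
  | mul y s hs => simp [hs, chevD_chevAd]

theorem one_mem_chevDeg : (1 : Chevalley k L) ∈ chevDeg k L 0 := by
  simp [chevDeg, Submodule.one_le.1 le_rfl]

theorem chevι_mul_mem {n : ℕ} (x : L) {s : Chevalley k L} (hs : s ∈ chevDeg k L n) :
    chevι k x * s ∈ chevDeg k L (n + 1) := by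
  rw [chevDeg, pow_succ']; exact Submodule.mul_mem_mul ⟨x, rfl⟩ hs

/-- Induction on homogeneous elements of the Chevalley complex. -/
theorem chevDeg_induction {P : ℕ → Chevalley k L → Prop} (one : P 0 1)
    (add : ∀ n a b, P n a → P n b → P n (a + b)) (smul : ∀ n (c : k) a, P n a → P n (c • a))
    (mul : ∀ n x s, s ∈ chevDeg k L n → P n s → P (n + 1) (chevι k x * s)) {n : ℕ}
    {s : Chevalley k L} (hs : s ∈ chevDeg k L n) : P n s := by
  induction hs using Submodule.pow_induction_on_left' with
  | algebraMap r => rw [Algebra.algebraMap_eq_smul_one]; exact smul _ _ _ one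
  | add x y i hx hy h1 h2 => exact add _ _ _ h1 h2
  | mem_mul m hm i x hx h => obtain ⟨m, rfl⟩ := hm; exact mul _ _ _ hx h

theorem chevAd_mem (x : L) {n : ℕ} {s : Chevalley k L} (hs : s ∈ chevDeg k L n) :
    chevAd k x s ∈ chevDeg k L n := by
  refine chevDeg_induction k (P := fun n s => chevAd k x s ∈ chevDeg k L n) ?_ ?_ ?_ ?_ hs
  · simp
  · intro n a b ha hb; rw [map_add]; exact add_mem ha hb
  · intro n c a ha; rw [map_smul]; exact Submodule.smul_mem _ _ ha
  · intro n y w hw h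
    rw [chevAd_mul]
    exact add_mem (chevι_mul_mem k _ hw) (chevι_mul_mem k _ h)

theorem chevD_mem {n : ℕ} {s : Chevalley k L} (hs : s ∈ chevDeg k L n) :
    chevD k L s ∈ chevDeg k L (n - 1) := by
  refine (chevDeg_induction k (P := fun n s => chevD k L s ∈ chevDeg k L (n - 1) ∧
    (n = 0 → chevD k L s = 0)) ?_ ?_ ?_ ?_ hs).1
  · simp
  · intro n a b ha hb
    rw [map_add]
    exact ⟨add_mem ha.1 hb.1, fun h => by rw [ha.2 h, hb.2 h, add_zero]⟩
  · intro n c a ha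
    rw [map_smul]
    exact ⟨Submodule.smul_mem _ _ ha.1, fun h => by rw [ha.2 h, smul_zero]⟩
  · intro n x s hs h
    rw [chevD_mul]
    refine ⟨sub_mem (chevAd_mem k x hs) ?_, fun h => by omega⟩
    cases n with
    | zero => simp [h.2 rfl]
    | succ n => exact chevι_mul_mem k x h.1

end Chevalley

section CycleMap

attribute [local instance 100] LieRing.ofAssociativeRing

variable (k : Type*) (M : Type*) [CommRing k] [Ring M] [Algebra k M]

/-- The operator `s ↦ [x] s + (insertion of x in s)` on `Sym(C^λ(M)[1])`: the letter `x` either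
becomes a new cycle or is inserted, with the Koszul sign, at one of the places of one of the
cycles. -/
def cycleStep : M →ₗ[k] Module.End k (ConnesSym k M) where
  toFun x := LinearMap.mulLeft k (symι k (cyc k (ι k x))) + symInsert k x
  map_add' x y := by
    refine LinearMap.ext fun s => ?_
    simp [add_mul, symInsert_add]; abel
  map_smul' c x := by
    refine LinearMap.ext fun s => ?_
    simp [symInsert_smul]

variable {M}

@[simp] theorem cycleStep_apply (x : M) (s : ConnesSym k M) :
    cycleStep k M x s = symι k (cyc k (ι k x)) * s + symInsert k x s := rfl

theorem cycleStep_comm (x y : M) (s : ConnesSym k M) :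
    cycleStep k M x (cycleStep k M y s) = -cycleStep k M y (cycleStep k M x s) := by
  have h1 := congrArg (· * s) (symι_comm k (cyc_mem k (ι_mem_wordDeg (k := k) x))
    (cyc_mem k (ι_mem_wordDeg (k := k) y)))
  have h2 := symInsert_symInsert k x y s
  have h3 : cyc k (ι k x * ι k y) = -cyc k (ι k y * ι k x) := by simp [cyc_rotate k x]
  simp only [cycleStep_apply, map_add, symInsert_mul, connesInsert_cyc, insertLetter_ι,
    connesSign_cyc, wordSign_ι, h3, map_neg]
  simp [mul_assoc] at h1
  simp
  linear_combination (norm := abel) h1 + h2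

variable (M) in
/-- The map `⨁ₙ Λⁿ M → Sym(C^λ(M)[1])` which sends `x₁ ∧ ⋯ ∧ xₙ` to the sum over all permutations
`σ` of `{1, …, n}` of the products, over the cycles `(i₁ i₂ … iₘ)` of `σ`, of the classes of
`x_{i₁} ⊗ x_{i₂} ⊗ ⋯ ⊗ x_{iₘ}`, with the sign of the permutation which takes `x₁, …, xₙ` to the
order in which they are written. It is built one letter at a time: every permutation of
`{1, …, n}` arises exactly once from a permutation of `{2, …, n}` by making `1` a new cycle or by
inserting it in a cycle. -/
def cycleMap : Chevalley k M →ₗ[k] ConnesSym k M :=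
  (LinearMap.applyₗ 1).comp (chevLift k (cycleStep k M) (fun x y =>
    LinearMap.ext fun s => cycleStep_comm k x y s)).toLinearMap

@[simp] theorem cycleMap_one : cycleMap k M 1 = 1 := by simp [cycleMap]

@[simp] theorem cycleMap_mul (x : M) (s : Chevalley k M) :
    cycleMap k M (chevι k x * s) =
      symι k (cyc k (ι k x)) * cycleMap k M s + symInsert k x (cycleMap k M s) := by
  simp [cycleMap]

theorem cycleMap_chevAd (x : M) (s : Chevalley k M) :
    cycleMap k M (chevAd k x s) = symAd k x (cycleMap k M s) := by
  induction s using chev_induction with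
  | one => simp
  | add a b ha hb => simp only [map_add, ha, hb]
  | smul c a ha => simp only [map_smul, ha]
  | mul y s hs =>
    have h := symAd_symInsert k x y (cycleMap k M s)
    simp only [chevAd_mul, map_add, cycleMap_mul, hs, symAd_mul, connesAd_cyc, adWord_ι]
    linear_combination (norm := abel) -h

theorem cycleMap_chevD (s : Chevalley k M) :
    cycleMap k M (chevD k M s) = symD k M (cycleMap k M s) := by
  induction s using chev_induction with
  | one => simp
  | add a b ha hb => simp only [map_add, ha, hb]
  | smul c a ha => simp only [map_smul, ha]
  | mul x s hs =>
    have h := symD_symInsert k x (cycleMap k M s)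
    have e : hochschildD k M (ι k x) = 0 := by simp [hochschildD]
    simp only [chevD_mul, map_sub, cycleMap_chevAd, cycleMap_mul, hs, map_add, symD_mul,
      connesD_cyc, connesSign_cyc, wordSign_ι, e, map_zero, zero_mul, map_neg, neg_mul]
    linear_combination (norm := abel) -h

theorem cycleMap_mem {n : ℕ} {s : Chevalley k M} (hs : s ∈ chevDeg k M n) :
    cycleMap k M s ∈ symDeg k M n := by
  refine chevDeg_induction k (P := fun n s => cycleMap k M s ∈ symDeg k M n) ?_ ?_ ?_ ?_ hs
  · simpa using one_mem_symDeg k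
  · intro n a b ha hb; rw [map_add]; exact add_mem ha hb
  · intro n c a ha; rw [map_smul]; exact Submodule.smul_mem _ _ ha
  · intro n x s _ h
    rw [cycleMap_mul]
    exact add_mem (symDeg_cast k (add_comm _ _)
      (symι_mul_mem_symDeg k (cyc_mem k (ι_mem_wordDeg x)) h)) (symInsert_mem k x h)

end CycleMap

section Trace

attribute [local instance 100] LieRing.ofAssociativeRing

open Matrix

variable (k : Type*) (m : Type*) (R : Type*) [CommRing k] [Fintype m] [DecidableEq m] [Ring R]
  [Algebra k R]

/-- The algebra map from words in matrices to matrices of words, sending the letter `(xᵢⱼ)` to the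
matrix of letters `xᵢⱼ`. -/
def matWord : TensorAlgebra k (Matrix m m R) →ₐ[k] Matrix m m (TensorAlgebra k R) :=
  TensorAlgebra.lift k (ι k).mapMatrix

/-- The trace on words:
`x₀ ⊗ ⋯ ⊗ xₙ ↦ ∑ (x₀)_{i₀ i₁} ⊗ (x₁)_{i₁ i₂} ⊗ ⋯ ⊗ (xₙ)_{iₙ i₀}` (for `n ≥ 0`). -/
def traceWord : TensorAlgebra k (Matrix m m R) →ₗ[k] TensorAlgebra k R :=
  (Matrix.traceLinearMap m k _).comp (matWord k m R).toLinearMap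

variable {m R}

@[simp] theorem matWord_ι_mul (x : Matrix m m R) (w : TensorAlgebra k (Matrix m m R)) (i j : m) :
    matWord k m R (ι k x * w) i j = ∑ a, ι k (x i a) * matWord k m R w a j := by
  simp [matWord, Matrix.mul_apply]

@[simp] theorem matWord_mul_ι (x : Matrix m m R) (w : TensorAlgebra k (Matrix m m R)) (i j : m) :
    matWord k m R (w * ι k x) i j = ∑ a, matWord k m R w i a * ι k (x a j) := by
  simp [matWord, Matrix.mul_apply]

theorem matWord_wordSign (w : TensorAlgebra k (Matrix m m R)) (i j : m) :
    matWord k m R (wordSign k _ w) i j = wordSign k R (matWord k m R w i j) := by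
  induction w using word_induction generalizing i j with
  | one => by_cases h : i = j <;> simp [h]
  | add a b ha hb => simp [ha, hb]
  | smul c a ha => simp [ha]
  | mul x w hw =>
    rw [map_mul (wordSign k _), wordSign_ι, neg_mul, map_neg, Matrix.neg_apply, matWord_ι_mul,
      matWord_ι_mul]
    simp [hw]

theorem matWord_headMul (x : Matrix m m R) (w : TensorAlgebra k (Matrix m m R)) (i j : m) :
    matWord k m R (headMul k w x) i j = ∑ a, headMul k (matWord k m R w a j) (x i a) := by
  induction w using word_cases_left with
  | one =>
    have : ∀ a, headMul k ((1 : Matrix m m (TensorAlgebra k R)) a j) (x i a) = 0 := fun a => by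
      by_cases h : a = j <;> simp [Matrix.one_apply, h]
    simp [this]
  | add a b ha hb => simp [ha, hb, Finset.sum_add_distrib]
  | smul c a ha => simp [ha, Finset.smul_sum]
  | mul y w => 
    simp only [headMul_mul, matWord_ι_mul, Matrix.mul_apply, map_sum, Finset.sum_mul,
      LinearMap.sum_apply]
    rw [Finset.sum_comm]

theorem matWord_barD (w : TensorAlgebra k (Matrix m m R)) (i j : m) :
    matWord k m R (barD k _ w) i j = barD k R (matWord k m R w i j) := by
  induction w using word_induction generalizing i j with
  | one => by_cases h : i = j <;> simp [h]
  | add a b ha hb => simp [ha, hb]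
  | smul c a ha => simp [ha]
  | mul x w hw =>
    rw [barD_mul, map_sub, Matrix.sub_apply, matWord_headMul, matWord_ι_mul, matWord_ι_mul, map_sum]
    simp [hw, Finset.sum_sub_distrib]

theorem traceWord_hochschildD (w : TensorAlgebra k (Matrix m m R)) :
    traceWord k m R (hochschildD k _ w) = hochschildD k R (traceWord k m R w) := by
  have h : traceWord k m R (lastFace k _ w) = lastFace k R (traceWord k m R w) := by
    simp only [traceWord, LinearMap.comp_apply, AlgHom.toLinearMap_apply,
      Matrix.traceLinearMap_apply, Matrix.trace, Matrix.diag]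
    induction w using word_cases_right with
    | one =>
      have : lastFace k R (Fintype.card m : TensorAlgebra k R) = 0 := by
        rw [← nsmul_one, map_nsmul, lastFace_one, smul_zero]
      simp [this]
    | add a b ha hb => simp_all [Finset.sum_add_distrib]
    | smul c a ha => simp_all [← Finset.smul_sum]
    | mul x w =>
      simp only [lastFace_mul, matWord_headMul, matWord_mul_ι, map_sum, matWord_wordSign]
      rw [Finset.sum_comm]
  have h' : traceWord k m R (barD k _ w) = barD k R (traceWord k m R w) := by
    simp [traceWord, Matrix.trace, matWord_barD]
  simp only [hochschildD, LinearMap.add_apply, map_add, h, h']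

variable (m R) in
/-- The trace map `C^λ(Mat_m(R)) → C^λ(R)`. -/
def connesTrace : Connes k (Matrix m m R) →ₗ[k] Connes k R :=
  connesLift k ((cyc k).comp (traceWord k m R)) (by
      have : cyc k (Fintype.card m : TensorAlgebra k R) = 0 := by
        rw [← nsmul_one, map_nsmul, cyc_one, smul_zero]
      simp [traceWord, this]) (fun x w => by
    simp only [LinearMap.comp_apply, traceWord, AlgHom.toLinearMap_apply,
      Matrix.traceLinearMap_apply, Matrix.trace, Matrix.diag, matWord_ι_mul, matWord_mul_ι,
      matWord_wordSign, map_sum]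
    rw [Finset.sum_comm]
    simp only [← cyc_rotate k])

@[simp] theorem connesTrace_cyc (w : TensorAlgebra k (Matrix m m R)) :
    connesTrace k m R (cyc k w) = cyc k (traceWord k m R w) := rfl

theorem connesTrace_connesD (u : Connes k (Matrix m m R)) :
    connesTrace k m R (connesD k _ u) = connesD k R (connesTrace k m R u) := by
  induction u using connes_induction with | h u
  simp [traceWord_hochschildD]

theorem connesTrace_connesSign (u : Connes k (Matrix m m R)) :
    connesTrace k m R (connesSign k _ u) = connesSign k R (connesTrace k m R u) := by
  induction u using connes_induction with | h u
  simp [traceWord, Matrix.trace, matWord_wordSign]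

theorem matWord_mem {n : ℕ} {w : TensorAlgebra k (Matrix m m R)}
    (hw : w ∈ wordDeg k (Matrix m m R) n) (i j : m) : matWord k m R w i j ∈ wordDeg k R n := by
  refine wordDeg_induction (P := fun n w => ∀ i j, matWord k m R w i j ∈ wordDeg k R n)
    ?_ ?_ ?_ ?_ hw i j
  · intro i j
    by_cases h : i = j
    · simp [h]
    · simp [h]
  · intro n a b ha hb i j; rw [map_add]; exact add_mem (ha i j) (hb i j)
  · intro n c a ha i j; rw [map_smul]; exact Submodule.smul_mem _ _ (ha i j)
  · intro n x w _ h i j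
    rw [matWord_ι_mul]
    exact Submodule.sum_mem _ fun a _ => ι_mul_mem_wordDeg _ (h a j)

theorem connesTrace_mem {n : ℕ} {u : Connes k (Matrix m m R)}
    (hu : u ∈ connesDeg k (Matrix m m R) n) : connesTrace k m R u ∈ connesDeg k R n := by
  obtain ⟨w, hw, rfl⟩ := hu
  exact ⟨_, Submodule.sum_mem _ fun i _ => matWord_mem k hw i i, rfl⟩

variable (m R) in
/-- The algebra map `Sym(C^λ(Mat_m(R))[1]) → Sym(C^λ(R)[1])` induced by the trace. -/
def symTrace : ConnesSym k (Matrix m m R) →ₐ[k] ConnesSym k R :=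
  symLift k ((symι k).comp (connesTrace k m R)) (fun _ _ _ _ hu hv =>
    symι_comm k (connesTrace_mem k hu) (connesTrace_mem k hv))

@[simp] theorem symTrace_symι (u : Connes k (Matrix m m R)) :
    symTrace k m R (symι k u) = symι k (connesTrace k m R u) := by simp [symTrace]

theorem symTrace_symD (s : ConnesSym k (Matrix m m R)) :
    symTrace k m R (symD k _ s) = symD k R (symTrace k m R s) := by
  induction s using sym_induction with
  | one => simp
  | add a b ha hb => simp only [map_add, ha, hb]
  | smul c a ha => simp only [map_smul, ha]
  | mul u s hs => simp [hs, connesTrace_connesD, connesTrace_connesSign]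

theorem symTrace_mem {n : ℕ} {s : ConnesSym k (Matrix m m R)}
    (hs : s ∈ symDeg k (Matrix m m R) n) : symTrace k m R s ∈ symDeg k R n := by
  refine symDeg_induction (P := fun n s => symTrace k m R s ∈ symDeg k R n) ?_ ?_ ?_ ?_ ?_ hs
  · simpa using one_mem_symDeg k
  · simp
  · intro n a b ha hb; rw [map_add]; exact add_mem ha hb
  · intro n c a ha; rw [map_smul]; exact Submodule.smul_mem _ _ ha
  · intro p n u s hu _ h
    rw [map_mul, symTrace_symι]
    exact symι_mul_mem_symDeg k (connesTrace_mem k hu) h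

variable (m R) in
/-- The Loday–Quillen–Tsygan map `⨁ₙ Λⁿ gl_m(R) → Sym(C^λ(R)[1])`, sending `x₁ ∧ ⋯ ∧ xₙ` to the
signed sum over the permutations `σ` of `{1, …, n}` of the products over the cycles
`(i₁ i₂ … iₗ)` of `σ` of the classes of `tr (x_{i₁} ⊗ ⋯ ⊗ x_{iₗ})`. -/
def kappa : Chevalley k (Matrix m m R) →ₗ[k] ConnesSym k R :=
  (symTrace k m R).toLinearMap.comp (cycleMap k (Matrix m m R))

theorem kappa_chevD (s : Chevalley k (Matrix m m R)) :
    kappa k m R (chevD k _ s) = symD k R (kappa k m R s) := by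
  simp [kappa, cycleMap_chevD, symTrace_symD]

theorem kappa_mem {n : ℕ} {s : Chevalley k (Matrix m m R)}
    (hs : s ∈ chevDeg k (Matrix m m R) n) : kappa k m R s ∈ symDeg k R n :=
  symTrace_mem k (cycleMap_mem k hs)

end Trace

section Complexes

open CategoryTheory

universe u

attribute [local instance 100] LieRing.ofAssociativeRing

/-- The differential `Λⁿ⁺¹ L → Λⁿ L`. -/
def chevDRestrict (k L : Type*) [CommRing k] [LieRing L] [LieAlgebra k L] (n : ℕ) :
    chevDeg k L (n + 1) →ₗ[k] chevDeg k L n :=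
  (chevD k L).restrict fun s hs => (by simpa using chevD_mem k hs : chevD k L s ∈ chevDeg k L n)

/-- The differential of `Sym(C^λ(R)[1])` from degree `n + 1` to degree `n`. -/
def symDRestrict (k R : Type*) [CommRing k] [Ring R] [Algebra k R] (n : ℕ) :
    symDeg k R (n + 1) →ₗ[k] symDeg k R n :=
  (symD k R).restrict fun s hs => (by simpa using symD_mem k hs : symD k R s ∈ symDeg k R n)

/-- The Loday–Quillen–Tsygan map in degree `n`. -/
def kappaRestrict (k m R : Type*) [CommRing k] [Fintype m] [DecidableEq m] [Ring R] [Algebra k R]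
    (n : ℕ) : chevDeg k (Matrix m m R) n →ₗ[k] symDeg k R n :=
  (kappa k m R).restrict fun _ hs => kappa_mem k hs

theorem chevDRestrict_comp (k L : Type*) [CommRing k] [LieRing L] [LieAlgebra k L] (n : ℕ) :
    chevDRestrict k L n ∘ₗ chevDRestrict k L (n + 1) = 0 :=
  LinearMap.ext fun s => Subtype.ext (chevD_chevD k s.1)

theorem symDRestrict_comp (k R : Type*) [CommRing k] [Ring R] [Algebra k R] (n : ℕ) :
    symDRestrict k R n ∘ₗ symDRestrict k R (n + 1) = 0 :=
  LinearMap.ext fun s => Subtype.ext (symD_symD k s.1)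

theorem symDRestrict_comp_kappaRestrict (k m R : Type*) [CommRing k] [Fintype m] [DecidableEq m]
    [Ring R] [Algebra k R] (n : ℕ) : symDRestrict k R n ∘ₗ kappaRestrict k m R (n + 1) =
      kappaRestrict k m R n ∘ₗ chevDRestrict k (Matrix m m R) n :=
  LinearMap.ext fun s => Subtype.ext (kappa_chevD k s.1).symm

/-- The Chevalley complex `C(L)` of a Lie algebra `L` over `k`, with trivial coefficients. -/
def chevalleyComplex (k : Type) [CommRing k] (L : Type u) [LieRing L] [LieAlgebra k L] :
    ChainComplex (ModuleCat.{u} k) ℕ :=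
  ChainComplex.of (fun n => ModuleCat.of k (chevDeg k L n))
    (fun n => ModuleCat.ofHom (chevDRestrict k L n))
    (fun n => ModuleCat.hom_ext (chevDRestrict_comp k L n))

theorem chevalleyComplex_d (k : Type) [CommRing k] (L : Type u) [LieRing L] [LieAlgebra k L]
    (n : ℕ) : (chevalleyComplex k L).d (n + 1) n = ModuleCat.ofHom (chevDRestrict k L n) := by
  simp [chevalleyComplex, ChainComplex.of.d]

/-- The complex `Sym(C^λ(R)[1])` of a `k`-algebra `R`. -/
def symConnesComplex (k : Type) [CommRing k] (R : Type u) [Ring R] [Algebra k R] :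
    ChainComplex (ModuleCat.{u} k) ℕ :=
  ChainComplex.of (fun n => ModuleCat.of k (symDeg k R n))
    (fun n => ModuleCat.ofHom (symDRestrict k R n))
    (fun n => ModuleCat.hom_ext (symDRestrict_comp k R n))

theorem symConnesComplex_d (k : Type) [CommRing k] (R : Type u) [Ring R] [Algebra k R] (n : ℕ) :
    (symConnesComplex k R).d (n + 1) n = ModuleCat.ofHom (symDRestrict k R n) := by
  simp [symConnesComplex, ChainComplex.of.d]

/-- The Loday–Quillen–Tsygan map `κ^r_R : C(gl_r(R)) → Sym(C^λ(R)[1])`. -/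
def lodayQuillenTsygan (k : Type) [CommRing k] (r : ℕ) (R : Type u) [Ring R] [Algebra k R] :
    chevalleyComplex k (Matrix (Fin r) (Fin r) R) ⟶ symConnesComplex k R :=
  ChainComplex.ofHom
    (fun n => ModuleCat.ofHom (kappaRestrict k (Fin r) R n))
    (fun n => by
      rw [chevalleyComplex_d, symConnesComplex_d]
      exact ModuleCat.hom_ext (symDRestrict_comp_kappaRestrict k (Fin r) R n))

end Complexes

end LQT

open CategoryTheory CategoryTheory.Limits

/-! The elementary matrices E_ab act on C(gl_r(R)) by chain maps, and κ kills every E_ab · s,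
because the trace of a commutator with E_ab vanishes. By Cartan's formula d(x ∧ z) = x · z − x ∧ dz,
the Casimir operator Ω = ∑ E_ab E_ba sends a cycle z to the boundary of ∑ E_ab · (E_ba ∧ z), an
element of Ker κ. So it is enough that some integral polynomial in Ω with nonzero constant term,
independent of R, annihilates the degree n part of Ker κ for n ≤ r.

On gl_r(ℤ)^{⊗ n} the matrix E_ab acts by an integer matrix whose transpose is the matrix of E_ba, so
Ω becomes a sum of products A Aᵀ. Positivity of sums of squares takes the place of complete
reducibility: `exists_aeval_mul_eq_zero` gives an integral polynomial q with q(0) ≠ 0 such that q(Ω)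
annihilates the image of every E_ab. Each row of q(Ω) is then an integral invariant functional on
gl_r^{⊗ n}. For n ≤ r an integral form of the first fundamental theorem, `IsInvariant.eq_sum_perm`,
writes it as a combination of the functionals attached to permutations.

These functionals are what κ records. With N the number of injections from `Fin n` to `Fin r`,
`card_smul_aeval_casimir` gives N q(Ω) z = q(Ω)(`kappaSection` (κ z)). Hence N q(Ω) z = 0 when κ z =
0. Writing q = X q₁ + q(0), a cycle z in Ker κ satisfies N q(0) z = −N Ω q₁(Ω) z, which is a
boundary in Ker κ (`exists_smul_boundary`). The constant N q(0) depends only on n and r, and the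
product over n ≤ r serves all degrees at once. -/

namespace LQT

open TensorAlgebra (ι)

attribute [local instance 100] LieRing.ofAssociativeRing

/-! ### Integer matrices of the form ∑ A Aᵀ -/

section SymmetricMatrices

open Polynomial Matrix

variable {n κ : Type*} [Fintype n] [Fintype κ]

theorem eq_zero_of_sum_mul_transpose_eq_zero (M : κ → Matrix n n ℤ)
    (h : ∑ x, M x * (M x)ᵀ = 0) (x : κ) : M x = 0 := by
  ext i j
  -- The diagonal entry (i, i) of the sum is the sum of the squares of all entries in the i-th rows.
  have h1 : ∑ x, ∑ j, M x i j * M x i j = 0 := by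
    simpa [Matrix.sum_apply, Matrix.mul_apply] using congrFun (congrFun h i) i
  have h2 := (Finset.sum_eq_zero_iff_of_nonneg fun x _ =>
    Finset.sum_nonneg fun j _ => mul_self_nonneg (M x i j)).1 h1 x (Finset.mem_univ _)
  have h3 := (Finset.sum_eq_zero_iff_of_nonneg fun j _ => mul_self_nonneg (M x i j)).1 h2 j
    (Finset.mem_univ _)
  simpa using h3

variable [DecidableEq n]

theorem transpose_aeval {Ω : Matrix n n ℤ} (h : Ωᵀ = Ω) (q : ℤ[X]) :
    (aeval Ω q)ᵀ = aeval Ω q := by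
  induction q using Polynomial.induction_on' with
  | add p q hp hq => simp [hp, hq]
  | monomial k a =>
    simp only [aeval_monomial, Algebra.algebraMap_eq_smul_one, smul_mul_assoc, one_mul,
      Matrix.transpose_smul, Matrix.transpose_pow, h]

/-- A symmetric integer matrix has no nilpotent part at 0: Ωᵀ Ω v = 0 forces Ω v = 0, which lowers
the exponent by one as long as it is at least 2. -/
theorem mul_eq_zero_of_pow_mul_eq_zero {Ω : Matrix n n ℤ} (h : Ωᵀ = Ω) (Q : Matrix n n ℤ) (k : ℕ)
    (hk : Ω ^ k * Q = 0) : Ω * Q = 0 := by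
  induction k with
  | zero => simp_all
  | succ k ih =>
    cases k with
    | zero => simpa using hk
    | succ k =>
      refine ih ?_
      have e : Ωᴴ * Ω * (Ω ^ k * Q) = 0 := by
        rw [conjTranspose_eq_transpose_of_trivial, h, ← hk, pow_succ', pow_succ']
        simp only [mul_assoc]
      rw [conjTranspose_mul_self_mul_eq_zero] at e
      rw [pow_succ', mul_assoc, e]

/-- Some integral polynomial in `∑ A Aᵀ` with nonzero constant term annihilates the images of all
the matrices `A`. -/
theorem exists_aeval_mul_eq_zero (A : κ → Matrix n n ℤ) :
    ∃ q : ℤ[X], q.coeff 0 ≠ 0 ∧ ∀ x, aeval (∑ x, A x * (A x)ᵀ) q * A x = 0 := by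
  set Ω := ∑ x, A x * (A x)ᵀ with hΩ
  have hs : Ωᵀ = Ω := by simp [hΩ, Matrix.transpose_sum]
  -- The polynomial q is the characteristic polynomial with all its factors X removed.
  obtain ⟨q, hq, hq0⟩ := exists_eq_pow_rootMultiplicity_mul_and_not_dvd Ω.charpoly
    (Matrix.charpoly_monic Ω).ne_zero 0
  rw [C_0, sub_zero] at hq hq0
  refine ⟨q, fun h => hq0 (X_dvd_iff.2 h), fun x => ?_⟩
  -- Cayley–Hamilton gives this with a power of Ω in front; symmetry reduces the power to 1.
  have h1 : Ω * aeval Ω q = 0 := by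
    refine mul_eq_zero_of_pow_mul_eq_zero hs _ (rootMultiplicity 0 Ω.charpoly) ?_
    have := Matrix.aeval_self_charpoly Ω
    rwa [hq, map_mul, map_pow, aeval_X] at this
  refine eq_zero_of_sum_mul_transpose_eq_zero (fun x => aeval Ω q * A x) ?_ x
  -- Since q(Ω) is symmetric, q(Ω) Ω q(Ω) is the sum of the (q(Ω) A)(q(Ω) A)ᵀ.
  have h2 : aeval Ω q * (∑ x, A x * (A x)ᵀ) * aeval Ω q = 0 := by
    rw [← hΩ, mul_assoc, h1, mul_zero]
  simp only [Matrix.transpose_mul, transpose_aeval hs]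
  rw [← h2, Finset.mul_sum, Finset.sum_mul]
  simp only [mul_assoc]

end SymmetricMatrices

/-! ### Integral invariant functionals on gl_r^{⊗ n} -/

section Invariants

open Function

/-- The index set of the standard basis of `gl_r^{⊗ n}`. -/
abbrev TensorIndex (n r : ℕ) : Type := (Fin n → Fin r) × (Fin n → Fin r)

variable {n r : ℕ}

/-- The matrix of the adjoint action of the elementary matrix `E_pq` on `gl_r^{⊗ n}`. -/
def adMatrix (p q : Fin r) : Matrix (TensorIndex n r) (TensorIndex n r) ℤ := fun y x =>
  ∑ m, ((if x.1 m = q ∧ y = (update x.1 m p, x.2) then 1 else 0) -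
    (if x.2 m = p ∧ y = (x.1, update x.2 m q) then 1 else 0))

theorem eq_update_comm {α : Type*} {f g : Fin n → α} {m : Fin n} {a b : α} :
    (f m = a ∧ g = update f m b) ↔ (g m = b ∧ f = update g m a) := by
  constructor <;> rintro ⟨rfl, rfl⟩ <;> simp

/-- Replacing a row index q by p is undone by replacing p by q, and likewise for columns. This makes
∑ E_pq E_qp a sum of products A Aᵀ. -/
theorem adMatrix_transpose (p q : Fin r) :
    (adMatrix p q : Matrix (TensorIndex n r) (TensorIndex n r) ℤ).transpose = adMatrix q p := by
  ext y x
  simp only [Matrix.transpose_apply, adMatrix, Prod.ext_iff]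
  refine Finset.sum_congr rfl fun m _ => ?_
  congr 1
  · refine if_congr ?_ rfl rfl
    rw [← and_assoc, eq_update_comm, and_assoc, eq_comm (a := x.2)]
  · refine if_congr ?_ rfl rfl
    rw [and_left_comm, eq_update_comm, and_left_comm, eq_comm (a := x.1)]

theorem sum_mul_adMatrix (l : TensorIndex n r → ℤ) (p q : Fin r) (x : TensorIndex n r) :
    ∑ y, l y * adMatrix p q y x =
      ∑ m, ((if x.1 m = q then l (update x.1 m p, x.2) else 0) -
        (if x.2 m = p then l (x.1, update x.2 m q) else 0)) := by
  simp only [adMatrix, Finset.mul_sum, mul_sub, ite_and]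
  rw [Finset.sum_comm]
  refine Finset.sum_congr rfl fun m _ => ?_
  rw [Finset.sum_sub_distrib]
  congr 1 <;> split_ifs <;> simp

/-- An invariant linear functional on `gl_r^{⊗ n}`, given by its values on the standard basis. -/
def IsInvariant (l : TensorIndex n r → ℤ) : Prop := ∀ (p q : Fin r) (i j : Fin n → Fin r),
  (∑ m, if i m = q then l (update i m p, j) else 0) = ∑ m, if j m = p then l (i, update j m q) else 0

theorem isInvariant_of_mul_adMatrix {l : TensorIndex n r → ℤ}
    (h : ∀ p q x, ∑ y, l y * adMatrix p q y x = 0) : IsInvariant l := fun p q i j => by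
  have := h p q (i, j)
  rwa [sum_mul_adMatrix, Finset.sum_sub_distrib, sub_eq_zero] at this

theorem exists_perm_comp_eq {i i' : Fin n → Fin r} (hi : Function.Injective i) (hi' : Function.Injective i') :
    ∃ π : Equiv.Perm (Fin r), π ∘ i = i' := by
  refine ⟨((Equiv.ofInjective i hi).symm.trans (Equiv.ofInjective i' hi')).extendSubtype,
    funext fun m => ?_⟩
  rw [Function.comp_apply, Equiv.extendSubtype_apply_of_mem _ _ ⟨m, rfl⟩, Equiv.trans_apply,
    Equiv.ofInjective_symm_apply, Equiv.ofInjective_apply]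

/-- As q is absent from i, it occurs in `update i a q` only at a. A matching of rows and columns
after the move is therefore the same matching as before it, and b is forced. -/
theorem update_eq_update_comp_iff {i j : Fin n → Fin r} {a b : Fin n} {q : Fin r}
    (hq : ∀ m, i m ≠ q) (σ : Equiv.Perm (Fin n)) :
    (j b = i a ∧ update j b q = update i a q ∘ σ) ↔ (b = σ.symm a ∧ j = i ∘ σ) := by
  constructor
  · rintro ⟨hb, h⟩
    have hba : b = σ.symm a := by
      have h1 := congrFun h b
      rw [update_self, Function.comp_apply] at h1
      by_contra hne
      rw [update_of_ne fun e => hne (by rw [← e, Equiv.symm_apply_apply])] at h1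
      exact hq _ h1.symm
    refine ⟨hba, funext fun m => ?_⟩
    by_cases hm : m = b
    · rw [hm, hb, Function.comp_apply, hba, Equiv.apply_symm_apply]
    · have h1 := congrFun h m
      rwa [update_of_ne hm, Function.comp_apply,
        update_of_ne fun e => hm (by rw [hba, ← e, Equiv.symm_apply_apply])] at h1
  · rintro ⟨rfl, rfl⟩
    simp [update_comp_equiv]

/-- The decreasing measure in `IsInvariant.eq_sum_perm`: moving one copy of a repeated index to an
unused one adds a distinct index. -/
theorem card_image_lt_card_image_update {i : Fin n → Fin r} {a a' : Fin n} (ha : a ≠ a')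
    (h : i a = i a') {q : Fin r} (hq : ∀ m, i m ≠ q) :
    (Finset.univ.image i).card < (Finset.univ.image (update i a q)).card := by
  rw [Nat.lt_iff_add_one_le, ← Finset.card_insert_of_notMem (a := q) (by simpa using hq)]
  refine Finset.card_le_card fun x hx => ?_
  simp only [Finset.mem_insert, Finset.mem_image, Finset.mem_univ, true_and] at hx ⊢
  rcases hx with rfl | ⟨m, rfl⟩
  · exact ⟨a, by simp⟩
  · by_cases hm : m = a
    · exact ⟨a', by rw [update_of_ne ha.symm, hm, h]⟩
    · exact ⟨m, by rw [update_of_ne hm]⟩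

namespace IsInvariant

variable {l : TensorIndex n r → ℤ} (hl : IsInvariant l)
include hl

/-- A weight argument: E_pp multiplies the basis element (i, j) by the number of occurrences of p in
i minus the number in j, so where l is nonzero these counts agree for every p. -/
theorem exists_perm_of_ne_zero {i j : Fin n → Fin r} (h : l (i, j) ≠ 0) :
    ∃ σ : Equiv.Perm (Fin n), j = i ∘ σ := by
  have hc : ∀ p, Fintype.card {m // j m = p} = Fintype.card {m // i m = p} := fun p => by
    have h1 := hl p p i j
    have e1 : (∑ m, if i m = p then l (update i m p, j) else 0) =
        Fintype.card {m // i m = p} * l (i, j) := by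
      rw [Fintype.card_subtype, ← nsmul_eq_mul, ← Finset.sum_const, Finset.sum_filter]
      refine Finset.sum_congr rfl fun m _ => ?_
      split_ifs with hm
      · rw [← hm, update_eq_self]
      · rfl
    have e2 : (∑ m, if j m = p then l (i, update j m p) else 0) =
        Fintype.card {m // j m = p} * l (i, j) := by
      rw [Fintype.card_subtype, ← nsmul_eq_mul, ← Finset.sum_const, Finset.sum_filter]
      refine Finset.sum_congr rfl fun m _ => ?_
      split_ifs with hm
      · rw [← hm, update_eq_self]
      · rfl
    rw [e1, e2] at h1
    exact_mod_cast (mul_right_cancel₀ h h1).symm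
  -- Bijections between the fibres of j and i over each index p glue to a permutation.
  refine ⟨Equiv.ofFiberEquiv fun p => Fintype.equivOfCardEq (hc p), funext fun m => ?_⟩
  exact (Equiv.ofFiberEquiv_map _ m).symm

/-- Invariance under E_{i a, q}, applied at the row tuple where place a already carries the unused
index q: the row side then has the single term at a. -/
theorem move {i : Fin n → Fin r} (j : Fin n → Fin r) (a : Fin n) {q : Fin r} (hq : ∀ m, i m ≠ q) :
    l (i, j) = ∑ b, if j b = i a then l (update i a q, update j b q) else 0 := by
  rw [← hl (i a) q (update i a q) j, Fintype.sum_eq_single a]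
  · simp
  · intro m hm
    simp [update_of_ne hm, hq]

/-- For injective i the sum in `move` has only one nonzero term, at the place of the column index i
a. -/
theorem swap_of_notMem {i : Fin n → Fin r} (hi : Function.Injective i) (τ : Equiv.Perm (Fin n)) (a : Fin n)
    {q : Fin r} (hq : ∀ m, i m ≠ q) :
    l (Equiv.swap (i a) q ∘ i, Equiv.swap (i a) q ∘ i ∘ τ) = l (i, i ∘ τ) := by
  have e1 : Equiv.swap (i a) q ∘ i = update i a q := by
    funext m
    by_cases hm : m = a
    · subst hm; simp
    · simp [update_of_ne hm, Equiv.swap_apply_of_ne_of_ne (hi.ne hm) (hq m)]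
  rw [hl.move (i ∘ τ) a hq, Fintype.sum_eq_single (τ.symm a), ← comp_assoc, e1]
  · have : update (i ∘ τ) (τ.symm a) q = update i a q ∘ τ := by
      rw [Function.update_comp_equiv]
    simp [this]
  · intro b hb
    rw [if_neg]
    intro h
    exact hb (by rw [← hi h, Equiv.symm_apply_apply])

/-- When n = r there is no unused index to pass through, so the exchange goes through a tuple in
which p occurs twice. Two invariance relations share both the term at (`update i b p`, `update j d
p`) and the term at (swapped i, j). Comparing them leaves the claim, with no division. -/
theorem swap_of_mem {i : Fin n → Fin r} (hi : Function.Injective i) (τ : Equiv.Perm (Fin n)) {a b : Fin n}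
    (hab : a ≠ b) :
    l (Equiv.swap (i a) (i b) ∘ i, Equiv.swap (i a) (i b) ∘ i ∘ τ) = l (i, i ∘ τ) := by
  set p := i a with hp
  set q := i b with hq
  have hpq : p ≠ q := hi.ne hab
  set j := i ∘ τ with hj
  have hji : Function.Injective j := hi.comp τ.injective
  set c := τ.symm a with hc
  set d := τ.symm b with hd
  have hcd : c ≠ d := τ.symm.injective.ne hab
  have hjc : j c = p := by simp [hj, hc, hp]
  have hjd : j d = q := by simp [hj, hd, hq]
  -- In the tuple with p doubled, changing the first copy of p to q gives the swapped tuple, and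
  -- changing the second gives f back.
  have key : ∀ {f : Fin n → Fin r} {a b : Fin n}, Function.Injective f → f a = p → f b = q →
      Equiv.swap p q ∘ f = update (update f b p) a q ∧ f = update (update f b p) b q := by
    intro f a b hf ha hb
    refine ⟨funext fun m => ?_, by simp [← hb]⟩
    by_cases hm : m = a
    · subst hm; simp [ha]
    rw [update_of_ne hm]
    by_cases hm' : m = b
    · subst hm'; simp [hb]
    rw [update_of_ne hm', Function.comp_apply, Equiv.swap_apply_of_ne_of_ne]
    · exact ha ▸ hf.ne hm
    · exact hb ▸ hf.ne hm'
  have vals : ∀ {f : Fin n → Fin r} {a b : Fin n}, a ≠ b → Function.Injective f → f a = p → f b = q →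
      ∀ m, update f b p m = p ↔ m = a ∨ m = b := by
    intro f a b hab hf ha hb m
    by_cases hm' : m = b
    · subst hm'; simp
    · rw [update_of_ne hm', ← ha]
      simp [hf.eq_iff, hm']
  obtain ⟨ki, ki'⟩ := key hi hp.symm hq.symm
  obtain ⟨kj, kj'⟩ := key hji hjc hjd
  -- This becomes l (swapped i, j) + l (i, j) = l (`update i b p`, `update j d p`).
  have r1 := hl q p (update i b p) j
  rw [Fintype.sum_eq_add a b hab, Fintype.sum_eq_single d, if_pos, if_pos, if_pos, ← ki, ← ki'] at r1
  rotate_left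
  · exact hjd
  · exact (vals hab hi rfl rfl b).2 (Or.inr rfl)
  · exact (vals hab hi rfl rfl a).2 (Or.inl rfl)
  · intro m hm; rw [if_neg]; exact fun h => hm (hji (h.trans hjd.symm))
  · rintro m ⟨hm, hm'⟩; rw [if_neg]; exact fun h => ((vals hab hi rfl rfl m).1 h).elim hm hm'
  have hs : Function.Injective (Equiv.swap p q ∘ i) := (Equiv.injective _).comp hi
  have hsa : (Equiv.swap p q ∘ i) a = q := by simp [← hp]
  -- After the identification `e` below, this becomes l (`update i b p`, `update j d p`) = l
  -- (swapped i, swapped j) + l (swapped i, j).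
  have r2 := hl p q (Equiv.swap p q ∘ i) (update j d p)
  rw [Fintype.sum_eq_single a, Fintype.sum_eq_add c d hcd, if_pos, if_pos, if_pos, ← kj, ← kj'] at r2
  rotate_left
  · exact (vals hcd hji hjc hjd d).2 (Or.inr rfl)
  · exact (vals hcd hji hjc hjd c).2 (Or.inl rfl)
  · exact hsa
  · rintro m ⟨hm, hm'⟩; rw [if_neg]; exact fun h => ((vals hcd hji hjc hjd m).1 h).elim hm hm'
  · intro m hm; rw [if_neg]; exact fun h => hm (hs (h.trans hsa.symm))
  have e : update (Equiv.swap p q ∘ i) a p = update i b p := by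
    rw [ki, update_idem]
    funext m
    by_cases hm : m = a
    · subst hm; simp [update_of_ne hab, ← hp]
    · rw [update_of_ne hm]
  rw [e] at r2
  linarith

/-- Transpositions generate the symmetric group; for each one, both, one or none of the exchanged
indices occur in the row tuple. In the last case the tuple does not change. -/
theorem perm_comp {i : Fin n → Fin r} (hi : Function.Injective i) (τ : Equiv.Perm (Fin n))
    (π : Equiv.Perm (Fin r)) : l (π ∘ i, π ∘ i ∘ τ) = l (i, i ∘ τ) := by
  induction π using Equiv.Perm.swap_induction_on with
  | one => simp
  | swap_mul f x y hxy ih =>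
    rw [← ih]
    have hi' : Function.Injective (f ∘ i) := f.injective.comp hi
    have hcomp : ∀ u : Fin n → Fin r, ⇑(Equiv.swap x y * f) ∘ u = Equiv.swap x y ∘ (f ∘ u) :=
      fun u => rfl
    rw [hcomp, hcomp, ← comp_assoc f i τ]
    generalize f ∘ i = i at hi'
    by_cases hx : ∃ a, i a = x
    · obtain ⟨a, rfl⟩ := hx
      by_cases hy : ∃ b, i b = y
      · obtain ⟨b, rfl⟩ := hy
        exact hl.swap_of_mem hi' τ fun h => hxy (congrArg i h)
      · exact hl.swap_of_notMem hi' τ a fun m h => hy ⟨m, h⟩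
    · by_cases hy : ∃ b, i b = y
      · obtain ⟨b, rfl⟩ := hy
        rw [Equiv.swap_comm]
        exact hl.swap_of_notMem hi' τ b fun m h => hx ⟨m, h⟩
      · have : Equiv.swap x y ∘ i = i := funext fun m =>
          Equiv.swap_apply_of_ne_of_ne (fun h => hx ⟨m, h⟩) (fun h => hy ⟨m, h⟩)
        rw [← comp_assoc, this]

/-- The values of an invariant functional in the stable range are determined by its values on the
basis elements with pairwise distinct row indices. -/
theorem eq_sum_perm (hn : n ≤ r) {i₀ : Fin n → Fin r} (h₀ : Function.Injective i₀) (i j : Fin n → Fin r) :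
    l (i, j) = ∑ σ : Equiv.Perm (Fin n), if j = i ∘ σ then l (i₀, i₀ ∘ σ) else 0 := by
  -- Induction on the number of repetitions among the row indices.
  obtain ⟨k, hk⟩ : ∃ k, k = n - (Finset.univ.image i).card := ⟨_, rfl⟩
  induction k using Nat.strong_induction_on generalizing i j with
  | h k ih =>
  by_cases hi : Function.Injective i
  · by_cases hj : ∃ τ : Equiv.Perm (Fin n), j = i ∘ τ
    · obtain ⟨τ, rfl⟩ := hj
      obtain ⟨π, rfl⟩ := exists_perm_comp_eq hi h₀
      rw [Fintype.sum_eq_single τ, if_pos rfl, comp_assoc, hl.perm_comp hi]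
      intro σ hσ
      rw [if_neg]
      exact fun h => hσ (Equiv.ext fun m => (hi (congrFun h m)).symm)
    · rw [Finset.sum_eq_zero fun σ _ => if_neg fun h => hj ⟨σ, h⟩]
      by_contra hz
      exact hj (hl.exists_perm_of_ne_zero hz)
  · obtain ⟨a, a', h, ha⟩ : ∃ a a', i a = i a' ∧ a ≠ a' := by simpa [Function.Injective] using hi
    -- The stable range enters here: if n ≤ r, a surjective i would force n = r and would then be
    -- injective.
    obtain ⟨q, hq⟩ : ∃ q, ∀ m, i m ≠ q := by
      by_contra! hs
      have hc := Fintype.card_le_of_surjective i hs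
      simp only [Fintype.card_fin] at hc
      obtain rfl := le_antisymm hn hc
      exact hi (Finite.injective_iff_surjective.2 hs)
    have hlt := card_image_lt_card_image_update ha h hq
    have hle : (Finset.univ.image (update i a q)).card ≤ n := by
      simpa using Finset.card_image_le (s := Finset.univ) (f := update i a q)
    rw [hl.move j a hq]
    -- Each σ with j = i ∘ σ contributes to exactly one b, namely σ⁻¹ a, so summing over b counts it
    -- once.
    have e : ∀ b, (if j b = i a then l (update i a q, update j b q) else 0) =
        ∑ σ : Equiv.Perm (Fin n), if b = σ.symm a ∧ j = i ∘ σ then l (i₀, i₀ ∘ σ) else 0 := by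
      intro b
      simp_rw [← update_eq_update_comp_iff hq, ite_and]
      split_ifs
      · exact ih _ (by omega) (update i a q) _ rfl
      · simp
    simp_rw [e]
    rw [Finset.sum_comm]
    simp_rw [ite_and]
    simp

end IsInvariant

end Invariants

/-! ### Traces of products of matrices with anticommuting entries -/

section OddEntries

open Matrix

variable {k M d A : Type*} [CommRing k] [Ring M] [Algebra k M] [Fintype d] [DecidableEq d] [Ring A]
  [Algebra k A]

/-- All entries of all the matrices `f x` anticommute. -/
def OddEntries (f : M →ₗ[k] Matrix d d A) : Prop :=
  ∀ x y i j i' j', f x i j * f y i' j' = -(f y i' j' * f x i j)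

/-- The value of a word under a linear map to matrices. -/
def evalWord (f : M →ₗ[k] Matrix d d A) : TensorAlgebra k M →ₐ[k] Matrix d d A :=
  TensorAlgebra.lift k f

@[simp] theorem evalWord_ι (f : M →ₗ[k] Matrix d d A) (x : M) : evalWord f (ι k x) = f x := by
  simp [evalWord]

theorem evalWord_ι_mul_apply (f : M →ₗ[k] Matrix d d A) (x : M) (w : TensorAlgebra k M) (i j : d) :
    evalWord f (ι k x * w) i j = ∑ l, f x i l * evalWord f w l j := by
  simp [Matrix.mul_apply]

theorem evalWord_mul_ι_apply (f : M →ₗ[k] Matrix d d A) (x : M) (w : TensorAlgebra k M) (i j : d) :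
    evalWord f (w * ι k x) i j = ∑ l, evalWord f w i l * f x l j := by
  simp [Matrix.mul_apply]

/-- Moving one odd entry past a word costs one sign per letter, which is what `wordSign` records. -/
theorem OddEntries.mul_evalWord {f : M →ₗ[k] Matrix d d A} (hf : OddEntries f) (x : M)
    (w : TensorAlgebra k M) (i j i' j' : d) :
    f x i j * evalWord f w i' j' = evalWord f (wordSign k M w) i' j' * f x i j := by
  induction w using word_induction generalizing i' j' with
  | one => by_cases h : i' = j' <;> simp [h]
  | add a b ha hb => simp [mul_add, add_mul, ha, hb]
  | smul c a ha => simp [ha]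
  | mul y w hw =>
    rw [map_mul (wordSign k M), wordSign_ι, neg_mul, map_neg, Matrix.neg_apply,
      evalWord_ι_mul_apply, evalWord_ι_mul_apply, Finset.mul_sum, neg_mul, Finset.sum_mul,
      ← Finset.sum_neg_distrib]
    refine Finset.sum_congr rfl fun l _ => ?_
    rw [← mul_assoc, hf x y, neg_mul, mul_assoc, hw, mul_assoc]

theorem OddEntries.evalWord_mul_evalWord {f : M →ₗ[k] Matrix d d A} (hf : OddEntries f) {p q : ℕ}
    {v w : TensorAlgebra k M} (hv : v ∈ wordDeg k M p) (hw : w ∈ wordDeg k M q) (i j i' j' : d) :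
    evalWord f v i j * evalWord f w i' j' =
      (-1 : k) ^ (p * q) • (evalWord f w i' j' * evalWord f v i j) := by
  refine wordDeg_induction (P := fun p v => ∀ i j, evalWord f v i j * evalWord f w i' j' =
      (-1 : k) ^ (p * q) • (evalWord f w i' j' * evalWord f v i j)) ?_ ?_ ?_ ?_ hv i j
  · intro i j; by_cases h : i = j <;> simp [h]
  · intro n a b ha hb i j; simp [mul_add, add_mul, ha, hb]
  · intro n c a ha i j; simp [ha, smul_comm c]
  · intro n x v _ hv i j
    simp only [evalWord_ι_mul_apply, Finset.sum_mul, Finset.mul_sum, Finset.smul_sum]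
    refine Finset.sum_congr rfl fun l _ => ?_
    rw [mul_assoc, hv, mul_smul_comm, ← mul_assoc, hf.mul_evalWord, wordSign_of_mem hw, map_smul,
      Matrix.smul_apply, smul_mul_assoc, smul_mul_assoc, smul_smul, ← pow_add, mul_assoc, Nat.succ_mul]

/-- The map `[x₁ ⊗ ⋯ ⊗ xₙ] ↦ tr (f x₁ ⋯ f xₙ)` for `n ≥ 1`. -/
def cycTrace {f : M →ₗ[k] Matrix d d A} (hf : OddEntries f) : Connes k M →ₗ[k] A :=
  -- The empty word is zero in the Connes complex but evaluates to the identity matrix, of trace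
  -- `Fintype.card d`; the second term removes this value and vanishes on nonempty words.
  connesLift k ((Matrix.traceLinearMap d k A).comp (evalWord f).toLinearMap -
      Fintype.card d • (Algebra.linearMap k A).comp
        (TensorAlgebra.algebraMapInv (R := k) (M := M)).toLinearMap)
    (by simp [Algebra.algebraMap_eq_smul_one]) (fun x w => by
      -- The trace is cyclic up to the Koszul sign, which matches the sign of the rotation.
      have e : ∑ i, evalWord f (ι k x * w) i i = ∑ i, evalWord f (wordSign k M w * ι k x) i i := by
        simp only [evalWord_ι_mul_apply, evalWord_mul_ι_apply, hf.mul_evalWord]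
        exact Finset.sum_comm
      simpa [TensorAlgebra.algebraMapInv, Matrix.trace] using e)

theorem cycTrace_cyc_ι_mul {f : M →ₗ[k] Matrix d d A} (hf : OddEntries f) (x : M)
    (w : TensorAlgebra k M) :
    cycTrace hf (cyc k (ι k x * w)) = (evalWord f (ι k x * w)).trace := by
  simp [cycTrace, TensorAlgebra.algebraMapInv]

theorem cycTrace_cyc_ι {f : M →ₗ[k] Matrix d d A} (hf : OddEntries f) (x : M) :
    cycTrace hf (cyc k (ι k x)) = (f x).trace := by
  simpa using cycTrace_cyc_ι_mul hf x 1

/-- The Connes complex is spanned by the classes of nonempty words. -/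
theorem connes_cases {P : Connes k M → Prop} (zero : P 0) (add : ∀ a b, P a → P b → P (a + b))
    (smul : ∀ (c : k) a, P a → P (c • a)) (mul : ∀ x w, P (cyc k (ι k x * w))) (u : Connes k M) :
    P u := by
  induction u using connes_induction with | h u
  induction u using word_cases_left with
  | one => simpa using zero
  | add a b ha hb => rw [map_add]; exact add _ _ ha hb
  | smul c a ha => rw [map_smul]; exact smul _ _ ha
  | mul x w => exact mul x w

/-- Expresses values by diagonal entries of a homogeneous word, to which the commutation rule for
entries applies. In degree 0 the class is zero and the word 0 represents it; in positive degree the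
correction for the empty word is absent. -/
theorem cycTrace_of_mem {f : M →ₗ[k] Matrix d d A} (hf : OddEntries f) {n : ℕ} {u : Connes k M}
    (hu : u ∈ connesDeg k M n) :
    ∃ w ∈ wordDeg k M n, cycTrace hf u = ∑ i, evalWord f w i i := by
  cases n with
  | zero =>
    rw [connesDeg_zero, Submodule.mem_bot] at hu
    exact ⟨0, zero_mem _, by simp [hu]⟩
  | succ n =>
    obtain ⟨w, hw, rfl⟩ := hu
    refine ⟨w, hw, ?_⟩
    refine (wordDeg_induction (P := fun n w => n ≠ 0 → cycTrace hf (cyc k w) =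
      (evalWord f w).trace) ?_ ?_ ?_ ?_ hw) n.succ_ne_zero
    · exact fun h => absurd rfl h
    · intro n a b ha hb hn; simp [ha hn, hb hn]
    · intro n c a ha hn; simp [ha hn]
    · intro n x w _ _ _; exact cycTrace_cyc_ι_mul hf x w

/-- The algebra map `Sym(C^λ(M)[1]) → A` with `[x₁ ⊗ ⋯ ⊗ xₙ] ↦ tr (f x₁ ⋯ f xₙ)`. -/
def symEval {f : M →ₗ[k] Matrix d d A} (hf : OddEntries f) : ConnesSym k M →ₐ[k] A :=
  symLift k (cycTrace hf) (fun p q u v hu hv => by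
    obtain ⟨a, ha, e⟩ := cycTrace_of_mem hf hu
    obtain ⟨b, hb, e'⟩ := cycTrace_of_mem hf hv
    simp only [e, e', Finset.sum_mul, Finset.mul_sum, Finset.smul_sum]
    rw [Finset.sum_comm]
    simp only [← hf.evalWord_mul_evalWord ha hb])

@[simp] theorem symEval_symι {f : M →ₗ[k] Matrix d d A} (hf : OddEntries f) (u : Connes k M) :
    symEval hf (symι k u) = cycTrace hf u := by simp [symEval]

/-- All maps involved are algebra maps, so agreement on cyclic words suffices. -/
theorem symEval_eq_of_evalWord {M' d' A' : Type*} [Ring M'] [Algebra k M'] [Fintype d'] [DecidableEq d']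
    {f : M →ₗ[k] Matrix d d A} (hf : OddEntries f) [Ring A'] [Algebra k A']
    {f' : M' →ₗ[k] Matrix d' d' A'} (hf' : OddEntries f') (g : A →ₐ[k] A')
    (t : ConnesSym k M →ₐ[k] ConnesSym k M')
    (h : ∀ x w, symEval hf' (t (symι k (cyc k (ι k x * w)))) = g (evalWord f (ι k x * w)).trace)
    (s : ConnesSym k M) : symEval hf' (t s) = g (symEval hf s) := by
  induction s using sym_induction with
  | one => simp
  | add a b ha hb => simp [ha, hb]
  | smul c a ha => simp [ha]
  | mul u s hs =>
    rw [map_mul, map_mul, hs, map_mul, map_mul]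
    congr 1
    induction u using connes_cases with
    | zero => simp
    | add a b ha hb => simp only [map_add, ha, hb]
    | smul c a ha => simp only [map_smul, ha]
    | mul x w => rw [h, symEval_symι, cycTrace_cyc_ι_mul]

end OddEntries

/-! ### The universal matrix (E_ij(x)) and insertion of a letter as a derivation -/

section Universal

open Matrix

variable (k : Type*) {M : Type*} (d : Type*) [CommRing k] [Ring M] [Algebra k M] [Fintype d]
  [DecidableEq d]

/-- The matrix of the elements `E_ij(x)` of the Chevalley complex of `gl_d(M)`. -/
def chevEntries : M →ₗ[k] Matrix d d (Chevalley k (Matrix d d M)) where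
  toFun x := of fun i j => chevι k (single i j x)
  map_add' x y := by ext; simp [Matrix.single_add]
  map_smul' c x := by ext; simp [← Matrix.smul_single]

variable {d}

@[simp] theorem chevEntries_apply (x : M) (i j : d) :
    chevEntries k d x i j = chevι k (single i j x) := rfl

theorem oddEntries_chevEntries : OddEntries (chevEntries k d (M := M)) :=
  fun _ _ _ _ _ _ => chevι_comm k _ _

/-- Insertion of the letter `x` before a letter, on the generators of the Chevalley complex of
`gl_d(M)`. -/
def glInsertGen (x : M) : Matrix d d M →ₗ[k] Chevalley k (Matrix d d M) where
  toFun Y := ∑ i, ∑ j, ∑ l, chevι k (single i l x) * chevι k (single l j (Y i j))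
  map_add' Y Z := by simp [Matrix.single_add, mul_add, Finset.sum_add_distrib]
  map_smul' c Y := by simp [← Matrix.smul_single, Finset.smul_sum]

theorem glInsertGen_single (x y : M) (i j : d) :
    glInsertGen k x (single i j y) =
      ∑ l, chevι k (single i l x) * chevι k (single l j y) := by
  simp only [glInsertGen, LinearMap.coe_mk, AddHom.coe_mk]
  rw [Fintype.sum_eq_single i, Fintype.sum_eq_single j]
  · simp
  · intro j' hj; simp [hj.symm]
  · intro i' hi; simp [hi.symm]

/-- A product of two odd elements is even. This commutation makes the odd derivation compatible with
the relations of the Chevalley algebra. -/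
theorem glInsertGen_comm (x : M) (Y Z : Matrix d d M) :
    glInsertGen k x Y * chevι k Z = chevι k Z * glInsertGen k x Y := by
  simp only [glInsertGen, LinearMap.coe_mk, AddHom.coe_mk, Finset.sum_mul, Finset.mul_sum]
  refine Finset.sum_congr rfl fun i _ => Finset.sum_congr rfl fun j _ =>
    Finset.sum_congr rfl fun l _ => ?_
  rw [mul_assoc, chevι_comm k _ Z, mul_neg, ← mul_assoc, chevι_comm k _ Z, neg_mul, neg_neg,
    mul_assoc]

/-- Auxiliary to `glInsert`. -/
def glInsertHom (x : M) : Chevalley k (Matrix d d M) →ₐ[k]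
    Module.End k (Chevalley k (Matrix d d M) × Chevalley k (Matrix d d M)) :=
  chevLift k
    { toFun := fun Y =>
        ((LinearMap.mulLeft k (chevι k Y)).comp (LinearMap.fst k _ _)).prod
          ((LinearMap.mulLeft k (glInsertGen k x Y)).comp (LinearMap.fst k _ _) -
            (LinearMap.mulLeft k (chevι k Y)).comp (LinearMap.snd k _ _))
      map_add' := fun y z => by
        refine LinearMap.ext fun ⟨s, t⟩ => ?_
        simp [add_mul]; abel
      map_smul' := fun c y => by
        refine LinearMap.ext fun ⟨s, t⟩ => ?_
        simp [smul_sub] }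
    (fun Y Z => by
      refine LinearMap.ext fun ⟨s, t⟩ => ?_
      simp [mul_sub, ← mul_assoc, chevι_comm k Y Z, glInsertGen_comm]
      abel)

/-- The odd derivation of the Chevalley complex of `gl_d(M)` with
`E_ij(y) ↦ ∑ E_il(x) ∧ E_lj(y)`. -/
def glInsert (x : M) : Chevalley k (Matrix d d M) →ₗ[k] Chevalley k (Matrix d d M) :=
  (LinearMap.snd k _ _).comp ((LinearMap.applyₗ (1, 0)).comp (glInsertHom k x).toLinearMap)

theorem glInsertHom_apply (x : M) (s : Chevalley k (Matrix d d M)) :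
    glInsertHom k x s (1, 0) = (s, glInsert k x s) := by
  refine Prod.ext ?_ rfl
  induction s using chev_induction with
  | one => simp
  | add a b ha hb => simp_all
  | smul c a ha => simp_all
  | mul y s hs =>
    rw [map_mul, Module.End.mul_apply]
    simpa [glInsertHom] using congrArg (chevι k y * ·) hs

@[simp] theorem glInsert_one (x : M) : glInsert k x (1 : Chevalley k (Matrix d d M)) = 0 := by
  simp [glInsert]

@[simp] theorem glInsert_mul (x : M) (Y : Matrix d d M) (s : Chevalley k (Matrix d d M)) :
    glInsert k x (chevι k Y * s) = glInsertGen k x Y * s - chevι k Y * glInsert k x s := by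
  change (glInsertHom k x (chevι k Y * s) (1, 0)).2 = _
  rw [map_mul, Module.End.mul_apply, glInsertHom_apply]
  simp [glInsertHom]

/-- In a product of matrices, replacing E_ij(y) by ∑ E_il(x) ∧ E_lj(y) places the matrix of x before
that of y. The Leibniz signs are those of `insertLetter`. -/
theorem glInsert_evalWord_mul (x : M) (w : TensorAlgebra k M) (i j : d)
    (s : Chevalley k (Matrix d d M)) :
    glInsert k x (evalWord (chevEntries k d) w i j * s) =
      evalWord (chevEntries k d) (insertLetter k x w) i j * s +
      evalWord (chevEntries k d) (wordSign k M w) i j * glInsert k x s := by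
  induction w using word_induction generalizing i j s with
  | one => by_cases h : i = j <;> simp [h]
  | add a b ha hb => simp only [map_add, Matrix.add_apply, add_mul, ha, hb]; abel
  | smul c a ha => simp only [map_smul, Matrix.smul_apply, smul_mul_assoc, ha, smul_add]
  | mul y w hw =>
    simp only [map_mul (wordSign k M), wordSign_ι, neg_mul, insertLetter_mul, map_neg, map_sub,
      Matrix.neg_apply, Matrix.sub_apply, evalWord_ι_mul_apply, Finset.sum_mul, map_sum,
      chevEntries_apply, mul_assoc, glInsert_mul, hw, glInsertGen_single, mul_add, Finset.mul_sum,
      Finset.sum_add_distrib, Finset.sum_sub_distrib, sub_mul]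
    rw [Finset.sum_comm]
    abel

/-- Carries the insertion term in the recursion of `cycleMap` over to the Chevalley algebra, where
products can be computed explicitly. -/
theorem symEval_symInsert (x : M) (s : ConnesSym k M) :
    symEval (oddEntries_chevEntries k (d := d)) (symInsert k x s) =
      glInsert k x (symEval (oddEntries_chevEntries k) s) := by
  induction s using sym_induction with
  | one => simp
  | add a b ha hb => simp only [map_add, ha, hb]
  | smul c a ha => simp only [map_smul, ha]
  | mul u s hs =>
    induction u using connes_cases with
    | zero => simp
    | add a b ha hb => simp only [map_add, add_mul, ha, hb]
    | smul c a ha => simp only [map_smul, smul_mul_assoc, ha]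
    | mul y w =>
      rw [symInsert_mul, map_add, map_mul (symEval _), map_mul (symEval _), map_mul (symEval _), hs, connesInsert_cyc, connesSign_cyc,
        symEval_symι, symEval_symι, symEval_symι, cycTrace_cyc_ι_mul, Matrix.trace, Finset.sum_mul,
        map_sum]
      simp only [Matrix.diag, glInsert_evalWord_mul, Finset.sum_add_distrib, ← Finset.sum_mul]
      congr 2
      -- Both terms of the insertion are nonempty words, so the plain trace formula applies to each.
      · rw [insertLetter_mul, map_sub, map_sub, cycTrace_cyc_ι_mul, cycTrace_cyc_ι_mul,
          ← Matrix.trace_sub, ← map_sub]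
        rfl
      · rw [map_mul (wordSign k M), wordSign_ι, neg_mul, map_neg, map_neg, cycTrace_cyc_ι_mul,
          ← Matrix.trace_neg, ← map_neg]
        rfl

end Universal

/-! ### Expansion of the cycle map over permutations -/

section Products

open Matrix Function

variable (k : Type*) [CommRing k]

/-- The product `x₀ ∧ ⋯ ∧ xₙ₋₁` in the Chevalley complex. -/
def chevProd {L : Type*} [LieRing L] [LieAlgebra k L] {n : ℕ} (x : Fin n → L) : Chevalley k L :=
  (List.ofFn fun m => chevι k (x m)).prod

variable {M d : Type*} [Ring M] [Algebra k M] [Fintype d] [DecidableEq d]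

/-- The product of the elements `E_{p_m q_m}(x_m)` in the Chevalley complex of `gl_d(M)`. -/
def glProd {n : ℕ} (p q : Fin n → d) (x : Fin n → M) : Chevalley k (Matrix d d M) :=
  chevProd k fun m => single (p m) (q m) (x m)

@[simp] theorem chevProd_zero {L : Type*} [LieRing L] [LieAlgebra k L] (x : Fin 0 → L) :
    chevProd k x = 1 := by simp [chevProd]

theorem chevProd_succ {L : Type*} [LieRing L] [LieAlgebra k L] {n : ℕ} (x : Fin (n + 1) → L) :
    chevProd k x = chevι k (x 0) * chevProd k (fun m => x m.succ) := by
  simp [chevProd, List.ofFn_succ]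

@[simp] theorem glProd_zero (p q : Fin 0 → d) (x : Fin 0 → M) : glProd k p q x = 1 := by
  simp [glProd]

theorem glProd_succ {n : ℕ} (p q : Fin (n + 1) → d) (x : Fin (n + 1) → M) :
    glProd k p q x = chevι k (single (p 0) (q 0) (x 0)) *
      glProd k (fun m => p m.succ) (fun m => q m.succ) (fun m => x m.succ) :=
  chevProd_succ k _

theorem update_succ_comp {α : Type*} {n : ℕ} (p : Fin (n + 1) → α) (m : Fin n) (l : α) :
    (fun a : Fin n => update p m.succ l a.succ) = update (fun a => p a.succ) m l := by
  funext a
  by_cases h : a = m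
  · subst h; simp
  · rw [update_of_ne h, update_of_ne (by simpa using h)]

theorem update_zero_comp {α : Type*} {n : ℕ} (p : Fin (n + 1) → α) (l : α) :
    (fun a : Fin n => update p 0 l a.succ) = fun a => p a.succ := by
  funext a
  rw [update_of_ne (Fin.succ_ne_zero a)]

/-- The Leibniz sign at the m-th factor cancels the sign of moving the new odd factor to the front,
so the formula has no signs. -/
theorem glInsert_glProd (x₀ : M) {n : ℕ} (p q : Fin n → d) (x : Fin n → M) :
    glInsert k x₀ (glProd k p q x) =
      ∑ m, ∑ l, chevι k (single (p m) l x₀) * glProd k (update p m l) q x := by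
  induction n with
  | zero => simp
  | succ n ih =>
    rw [glProd_succ, glInsert_mul, glInsertGen_single, ih, Fin.sum_univ_succ, sub_eq_add_neg]
    congr 1
    · rw [Finset.sum_mul]
      refine Finset.sum_congr rfl fun l _ => ?_
      rw [glProd_succ, update_self, update_zero_comp, mul_assoc]
    · rw [Finset.mul_sum, ← Finset.sum_neg_distrib]
      refine Finset.sum_congr rfl fun m _ => ?_
      rw [Finset.mul_sum, ← Finset.sum_neg_distrib]
      refine Finset.sum_congr rfl fun l _ => ?_
      rw [glProd_succ, update_succ_comp, update_of_ne (Fin.succ_ne_zero m).symm, ← mul_assoc,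
        ← mul_assoc, chevι_comm k (single (p m.succ) l x₀), neg_mul]

/-- Reindexing by the involution that exchanges the entry of the tuple at m with the separate index.
-/
theorem sum_update_swap {α d : Type*} [Fintype d] [AddCommMonoid α] {n : ℕ} (m : Fin n)
    (F : d → d → (Fin n → d) → (Fin n → d) → α) :
    ∑ I : Fin n → d, ∑ l, F (I m) l (update I m l) I =
      ∑ a, ∑ K : Fin n → d, F a (K m) K (update K m a) := by
  rw [Finset.sum_comm, ← Fintype.sum_prod_type', ← Fintype.sum_prod_type']
  refine Finset.sum_nbij' (fun z => (z.2 m, update z.2 m z.1)) (fun z => (z.2 m, update z.2 m z.1))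
    ?_ ?_ ?_ ?_ ?_ <;> simp

/-- The composite of the cycle map with the trace is the sum over all permutations of the products
of matrix entries. -/
theorem symEval_cycleMap_chevProd {n : ℕ} (x : Fin n → M) :
    symEval (oddEntries_chevEntries k (d := d)) (cycleMap k M (chevProd k x)) =
      ∑ σ : Equiv.Perm (Fin n), ∑ K : Fin n → d, glProd k K (K ∘ σ) x := by
  induction n with
  | zero => simp
  | succ n ih =>
    -- The equivalence `decomposeFin` splits a permutation into the image of 0 and a permutation e
    -- of the other places. Image 0 makes 0 a fixed point; image `m.succ` inserts 0 just before m in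
    -- its cycle. These cases match the two terms of `cycleMap_mul`.
    rw [chevProd_succ, cycleMap_mul, map_add, map_mul (symEval _), symEval_symInsert, ih,
      symEval_symι, cycTrace_cyc_ι, ← Equiv.sum_comp Equiv.Perm.decomposeFin.symm,
      Fintype.sum_prod_type, Fin.sum_univ_succ]
    congr 1
    · rw [Finset.mul_sum]
      refine Finset.sum_congr rfl fun e _ => ?_
      rw [← Equiv.sum_comp (Fin.consEquiv fun _ => d), Fintype.sum_prod_type, Matrix.trace,
        Finset.sum_mul]
      refine Finset.sum_congr rfl fun a _ => ?_
      rw [Finset.mul_sum]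
      refine Finset.sum_congr rfl fun K _ => ?_
      rw [glProd_succ]
      simp [Fin.consEquiv, comp_def]
    · simp only [map_sum, glInsert_glProd]
      rw [Finset.sum_congr rfl fun e _ => Finset.sum_comm, Finset.sum_comm]
      refine Finset.sum_congr rfl fun m _ => Finset.sum_congr rfl fun e _ => ?_
      -- After reindexing, a is the row index of the inserted letter and K gives the row indices of
      -- the others.
      rw [sum_update_swap m fun u l I' I => chevι k (single u l (x 0)) *
        glProd k I' (I ∘ e) fun m => x m.succ, ← Equiv.sum_comp (Fin.consEquiv fun _ => d),
        Fintype.sum_prod_type]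
      refine Finset.sum_congr rfl fun a _ => Finset.sum_congr rfl fun K _ => ?_
      rw [glProd_succ]
      congr 2
      funext b
      -- The place that e sends to m is now followed by the inserted letter, so its column index is
      -- a. All other column indices are those given by e.
      by_cases hb : e b = m
      · simp [Fin.consEquiv, hb]
      · rw [Function.comp_apply, update_of_ne hb, Function.comp_apply, Equiv.Perm.decomposeFin_symm_apply_succ,
          Equiv.swap_apply_of_ne_of_ne (Fin.succ_ne_zero _) (by simpa using hb)]
        simp [Fin.consEquiv]

end Products

/-! ### A section of κ up to a multiple and modulo coinvariants -/

section RowGrading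

open Matrix Function

variable (k : Type*) (m : Type*) (R : Type*) [CommRing k] [Fintype m] [DecidableEq m] [Ring R]
  [Algebra k R]

/-- The Chevalley complex of `gl_m(R)` with formal exponents recording how often each row index
occurs. -/
abbrev RowGraded : Type _ := AddMonoidAlgebra (Chevalley k (Matrix m m R)) (m → ℕ)

variable {R}

/-- The matrix of the elements `E_ij(a)`, with their row index recorded. -/
noncomputable def rowEntries : R →ₗ[k] Matrix m m (RowGraded k m R) where
  toFun a := of fun i j => AddMonoidAlgebra.single (Pi.single i 1) (chevι k (single i j a))
  map_add' x y := by ext; simp [Matrix.single_add]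
  map_smul' c x := by ext; simp [← Matrix.smul_single]

variable {m}

theorem rowEntries_apply (a : R) (i j : m) : rowEntries k m a i j =
    AddMonoidAlgebra.single (Pi.single i 1) (chevι k (single i j a)) := rfl

theorem oddEntries_rowEntries : OddEntries (rowEntries k m (R := R)) := by
  intro x y i j i' j'
  rw [rowEntries_apply, rowEntries_apply, AddMonoidAlgebra.single_mul_single,
    AddMonoidAlgebra.single_mul_single, chevι_comm, add_comm, AddMonoidAlgebra.single_neg]

/-- The linear map `E_{(i,a),(j,b)}(X) ↦ E_ij(X_ab)`, with the row index recorded. -/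
noncomputable def contractGen : Matrix (m × m) (m × m) (Matrix m m R) →ₗ[k] RowGraded k m R where
  toFun Y := ∑ K : m × m, ∑ K' : m × m, rowEntries k m (Y K K' K.2 K'.2) K.1 K'.1
  map_add' Y Z := by simp [Finset.sum_add_distrib]
  map_smul' c Y := by simp [Finset.smul_sum]

theorem contractGen_single (K K' : m × m) (X : Matrix m m R) :
    contractGen k (single K K' X) = rowEntries k m (X K.2 K'.2) K.1 K'.1 := by
  simp only [contractGen, LinearMap.coe_mk, AddHom.coe_mk]
  rw [Fintype.sum_eq_single K, Fintype.sum_eq_single K']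
  · simp
  · intro K'' h; rw [single_apply_of_ne]; · simp
    · rintro ⟨_, h'⟩; exact h h'.symm
  · intro K'' h
    refine Finset.sum_eq_zero fun K''' _ => ?_
    rw [single_apply_of_ne]; · simp
    · rintro ⟨h', _⟩; exact h h'.symm

/-- The algebra map `E_{(i,a),(j,b)}(X) ↦ E_ij(X_ab)`, with the row index recorded. -/
noncomputable def contract : Chevalley k (Matrix (m × m) (m × m) (Matrix m m R)) →ₐ[k] RowGraded k m R :=
  chevLift k (contractGen k) (fun Y Z => by
    simp only [contractGen, LinearMap.coe_mk, AddHom.coe_mk, ← Fintype.sum_prod_type',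
      Finset.sum_mul_sum, ← Finset.sum_neg_distrib]
    exact Fintype.sum_equiv (Equiv.prodComm _ _) _ _ fun x => oddEntries_rowEntries k _ _ _ _ _ _)

@[simp] theorem contract_chevι (Y : Matrix (m × m) (m × m) (Matrix m m R)) :
    contract k (chevι k Y) = contractGen k Y := chevLift_chevι k _ _ _

/-- In a pair index the second component is a matrix index of the letters and the first an index of
the evaluation. Contraction performs both matrix multiplications together. -/
theorem contract_evalWord (w : TensorAlgebra k (Matrix m m R)) (K K' : m × m) :
    contract k (evalWord (chevEntries k (m × m)) w K K') =
      evalWord (rowEntries k m) (matWord k m R w K.2 K'.2) K.1 K'.1 := by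
  induction w using word_induction generalizing K K' with
  | one =>
    rcases K with ⟨i, a⟩
    rcases K' with ⟨j, b⟩
    by_cases h : i = j <;> by_cases h' : a = b <;> simp [h, h']
  | add a b ha hb => simp [ha, hb]
  | smul c a ha => simp [ha]
  | mul x w hw =>
    simp only [evalWord_ι_mul_apply, matWord_ι_mul, map_sum, map_mul (contract k), hw,
      chevEntries_apply, contract_chevι, contractGen_single, Matrix.sum_apply,
      Fintype.sum_prod_type]
    exact Finset.sum_comm

/-- A trace over pairs is a trace over both components, so evaluation after the trace can be
computed in the Chevalley algebra over Mat_m(R), where `symEval_cycleMap_chevProd` applies. -/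
theorem symEval_symTrace (s : ConnesSym k (Matrix m m R)) :
    symEval (oddEntries_rowEntries k) (symTrace k m R s) =
      contract k (symEval (oddEntries_chevEntries k (d := m × m)) s) := by
  refine symEval_eq_of_evalWord _ _ (contract k) (symTrace k m R) (fun x w => ?_) s
  rw [symTrace_symι, symEval_symι, connesTrace_cyc]
  simp only [traceWord, LinearMap.comp_apply, AlgHom.toLinearMap_apply,
    Matrix.traceLinearMap_apply, Matrix.trace, Matrix.diag, map_sum, contract_evalWord,
    Fintype.sum_prod_type]
  rw [Finset.sum_comm]
  refine Finset.sum_congr rfl fun i _ => ?_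
  simp only [matWord_ι_mul, map_sum, cycTrace_cyc_ι_mul, Matrix.sum_apply]
  rw [Finset.sum_comm]
  rfl

theorem contract_glProd {n : ℕ} (K K' : Fin n → m × m) (x : Fin n → Matrix m m R) :
    contract k (glProd k K K' x) = AddMonoidAlgebra.single (∑ a, Pi.single (K a).1 1)
      (glProd k (fun a => (K a).1) (fun a => (K' a).1) fun a => x a (K a).2 (K' a).2) := by
  induction n with
  | zero => simp [AddMonoidAlgebra.one_def]
  | succ n ih =>
    rw [glProd_succ, map_mul, ih, contract_chevι, contractGen_single, rowEntries_apply,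
      AddMonoidAlgebra.single_mul_single, Fin.sum_univ_succ, ← glProd_succ k
        (fun a => (K a).1) (fun a => (K' a).1) fun a => x a (K a).2 (K' a).2]

/-- The sum of the multilinear coefficients. -/
noncomputable def multilinearPart : RowGraded k m R →ₗ[k] Chevalley k (Matrix m m R) where
  toFun b := b.coeff.sum fun e s => if ∀ i, e i ≤ 1 then s else 0
  map_add' x y := by
    rw [AddMonoidAlgebra.coeff_add, Finsupp.sum_add_index']
    · simp
    · intro e s t; split_ifs <;> simp
  map_smul' c x := by
    rw [AddMonoidAlgebra.coeff_smul, Finsupp.sum_smul_index', RingHom.id_apply, Finsupp.smul_sum]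
    · simp
    · simp

theorem multilinearPart_single (e : m → ℕ) (s : Chevalley k (Matrix m m R)) :
    multilinearPart k (AddMonoidAlgebra.single e s) = if ∀ i, e i ≤ 1 then s else 0 := by
  simp [multilinearPart, AddMonoidAlgebra.coeff_single]

/-- The exponent at i counts the places with row index i, so multilinear terms are those with
pairwise distinct row indices. -/
theorem sum_single_le_one_iff {m : Type*} [DecidableEq m] {n : ℕ} (I : Fin n → m) :
    (∀ i, (∑ a, Pi.single (I a) 1 : m → ℕ) i ≤ 1) ↔ Function.Injective I := by
  have h : ∀ i, (∑ a, Pi.single (I a) 1 : m → ℕ) i = (Finset.univ.filter fun a => I a = i).card := by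
    intro i
    simp [Finset.sum_apply, Pi.single_apply, eq_comm]
  simp only [h, Finset.card_le_one_iff, Finset.mem_filter, Finset.mem_univ, true_and]
  exact ⟨fun h a b hab => h (I b) hab rfl, fun h i a b ha hb => h (ha.trans hb.symm)⟩

/-- A left inverse of the Loday–Quillen–Tsygan map up to a multiple and modulo coinvariants:
`[a₁ ⊗ ⋯ ⊗ aₗ] ⋯` goes to the sum of the elements `E_{i₁i₂}(a₁) ∧ ⋯ ∧ E_{iₗi₁}(aₗ) ∧ ⋯` over all
choices of pairwise distinct indices. -/
noncomputable def kappaSection : ConnesSym k R →ₗ[k] Chevalley k (Matrix m m R) :=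
  (multilinearPart k).comp (symEval (oddEntries_rowEntries k)).toLinearMap

theorem glProd_eq_zero {d M : Type*} [Fintype d] [DecidableEq d] [Ring M] [Algebra k M] {n : ℕ}
    (p q : Fin n → d) {x : Fin n → M} {a : Fin n} (h : x a = 0) : glProd k p q x = 0 :=
  List.prod_eq_zero (List.mem_ofFn.2 ⟨a, by simp [h]⟩)

-- In the sum over tuples of pairs (I, J), the entry of E_{i b, j b}(a b) at (J b, J (σ b)) is zero
-- unless J b = i b and J (σ b) = j b. For all b together this forces J = i and j = i ∘ σ, while I
-- stays free and the multilinear part keeps only injective I.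
open Classical in
theorem kappaSection_kappa {n : ℕ} (i j : Fin n → m) (a : Fin n → R) :
    kappaSection k (kappa k m R (glProd k i j a)) =
      ∑ σ : Equiv.Perm (Fin n), if j = i ∘ σ then
        ∑ I : Fin n → m, if Function.Injective I then glProd k I (I ∘ σ) a else 0 else 0 := by
  rw [kappaSection, LinearMap.comp_apply, AlgHom.toLinearMap_apply, kappa, LinearMap.comp_apply,
    AlgHom.toLinearMap_apply, symEval_symTrace, glProd, symEval_cycleMap_chevProd, map_sum, map_sum]
  refine Finset.sum_congr rfl fun σ _ => ?_
  -- A tuple of pairs is split into the pair of tuples (I, J).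
  rw [map_sum, map_sum, ← Equiv.sum_comp (Equiv.arrowProdEquivProdArrow (Fin n) _ _).symm,
    Fintype.sum_prod_type]
  simp only [contract_glProd, multilinearPart_single, sum_single_le_one_iff]
  split_ifs with h
  · refine Finset.sum_congr rfl fun I _ => ?_
    rw [Fintype.sum_eq_single i]
    · subst h
      simp [comp_def]
    · intro J hJ
      obtain ⟨b, hb⟩ := Function.ne_iff.1 hJ
      have h0 : single (i b) (j b) (a b) (J b) ((J ∘ σ) b) = 0 :=
        single_apply_of_row_ne hb.symm _ _ _
      rw [glProd_eq_zero k _ _ (a := b) h0]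
      simp
  · refine Finset.sum_eq_zero fun I _ => Finset.sum_eq_zero fun J _ => ?_
    obtain ⟨b, hb⟩ : ∃ b, ¬(i b = J b ∧ j b = J (σ b)) := by
      by_contra! hJ
      exact h (funext fun b => by rw [(hJ b).2, Function.comp_apply, (hJ (σ b)).1])
    have h0 : single (i b) (j b) (a b) (J b) ((J ∘ σ) b) = 0 := single_apply_of_ne _ _ _ _ _ hb
    rw [glProd_eq_zero k _ _ (a := b) h0]
    simp

end RowGrading

/-! ### The Casimir operator and boundaries in Ker κ -/

section Casimir

open Matrix Function Polynomial

variable (k : Type*) [CommRing k] {r : ℕ} (R : Type*) [Ring R] [Algebra k R]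

theorem lie_single_one_single {m : Type*} [Fintype m] [DecidableEq m] {R : Type*} [Ring R]
    (p q i j : m) (a : R) : ⁅single p q (1 : R), single i j a⁆ =
      (if i = q then single p j a else 0) - (if j = p then single i q a else 0) := by
  rw [Ring.lie_def]
  congr 1
  · split_ifs with h
    · subst h; simp
    · exact single_mul_single_of_ne _ _ _ _ (Ne.symm h) _
  · split_ifs with h
    · subst h; simp
    · exact single_mul_single_of_ne _ _ _ _ h _

theorem chevAd_glProd {R} [Ring R] [Algebra k R] {n : ℕ} (p q : Fin r) (i j : Fin n → Fin r) (a : Fin n → R) :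
    chevAd k (single p q (1 : R)) (glProd k i j a) =
      ∑ m, ((if i m = q then glProd k (update i m p) j a else 0) -
        (if j m = p then glProd k i (update j m q) a else 0)) := by
  induction n with
  | zero => simp
  | succ n ih =>
    rw [glProd_succ, chevAd_mul, ih, Fin.sum_univ_succ, lie_single_one_single]
    congr 1
    · rw [map_sub, sub_mul]
      congr 1 <;> split_ifs with h
      · rw [glProd_succ, update_self, update_zero_comp]
      · simp
      · rw [glProd_succ, update_self, update_zero_comp]
      · simp
    · rw [Finset.mul_sum]
      refine Finset.sum_congr rfl fun m _ => ?_
      rw [mul_sub, mul_ite, mul_ite, mul_zero]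
      congr 1 <;> refine if_congr Iff.rfl ?_ rfl
      · rw [glProd_succ k (update i m.succ p), update_succ_comp, update_of_ne (Fin.succ_ne_zero m).symm]
      · rw [glProd_succ k i (update j m.succ q), update_succ_comp, update_of_ne (Fin.succ_ne_zero m).symm]

/-- Evaluation of an element of `gl_r(ℤ)^{⊗ n}` on coefficients in `R`. -/
def tensorEval {R} [Ring R] [Algebra k R] {n : ℕ} (a : Fin n → R) :
    (TensorIndex n r → ℤ) →ₗ[ℤ] Chevalley k (Matrix (Fin r) (Fin r) R) :=
  Fintype.linearCombination ℤ fun x => glProd k x.1 x.2 a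

theorem tensorEval_apply {R} [Ring R] [Algebra k R] {n : ℕ} (a : Fin n → R) (v : TensorIndex n r → ℤ) :
    tensorEval k a v = ∑ x, v x • glProd k x.1 x.2 a := rfl

theorem tensorEval_single {R} [Ring R] [Algebra k R] {n : ℕ} (a : Fin n → R) (x : TensorIndex n r) :
    tensorEval k a (Pi.single x 1) = glProd k x.1 x.2 a := by
  simp [tensorEval]

theorem tensorEval_adMatrix_col {R} [Ring R] [Algebra k R] {n : ℕ} (a : Fin n → R) (p q : Fin r)
    (x : TensorIndex n r) :
    ∑ y, adMatrix p q y x • glProd k y.1 y.2 a =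
      chevAd k (single p q (1 : R)) (glProd k x.1 x.2 a) := by
  rw [chevAd_glProd]
  simp only [adMatrix, Finset.sum_smul, sub_smul, ite_smul, one_smul, zero_smul, ite_and]
  rw [Finset.sum_comm]
  refine Finset.sum_congr rfl fun m _ => ?_
  rw [Finset.sum_sub_distrib]
  congr 1 <;> split_ifs <;> simp

/-- The same integer matrix describes the action for every R and all coefficients, which is why the
final constant does not depend on R. -/
theorem tensorEval_adMatrix {R} [Ring R] [Algebra k R] {n : ℕ} (a : Fin n → R) (p q : Fin r)
    (v : TensorIndex n r → ℤ) :
    tensorEval k a (adMatrix p q *ᵥ v) = chevAd k (single p q (1 : R)) (tensorEval k a v) := by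
  simp only [tensorEval_apply, map_sum, map_zsmul, ← tensorEval_adMatrix_col, Matrix.mulVec,
    dotProduct, Finset.sum_smul, Finset.smul_sum, smul_smul]
  rw [Finset.sum_comm]
  simp only [mul_comm]

variable (r) in
/-- The action of the Casimir element `∑ E_pq E_qp` on the Chevalley complex. -/
def casimir : Module.End k (Chevalley k (Matrix (Fin r) (Fin r) R)) :=
  ∑ x : Fin r × Fin r, chevAd k (single x.1 x.2 (1 : R)) * chevAd k (single x.2 x.1 (1 : R))

variable (r) in
/-- The matrix of the action of the Casimir element on `gl_r^{⊗ n}`. -/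
def casimirMatrix (n : ℕ) : Matrix (TensorIndex n r) (TensorIndex n r) ℤ :=
  ∑ x : Fin r × Fin r, adMatrix x.1 x.2 * (adMatrix x.1 x.2)ᵀ

variable {R}

theorem casimir_apply (s : Chevalley k (Matrix (Fin r) (Fin r) R)) : casimir k r R s =
    ∑ x : Fin r × Fin r,
      chevAd k (single x.1 x.2 (1 : R)) (chevAd k (single x.2 x.1 (1 : R)) s) := by
  simp [casimir, LinearMap.sum_apply]

theorem tensorEval_casimirMatrix {n : ℕ} (a : Fin n → R) (v : TensorIndex n r → ℤ) :
    tensorEval k a (casimirMatrix r n *ᵥ v) = casimir k r R (tensorEval k a v) := by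
  simp only [casimirMatrix, casimir_apply, Matrix.sum_mulVec, map_sum, adMatrix_transpose,
    ← Matrix.mulVec_mulVec, tensorEval_adMatrix]

theorem tensorEval_aeval {n : ℕ} (a : Fin n → R) (q : ℤ[X]) (v : TensorIndex n r → ℤ) :
    tensorEval k a (aeval (casimirMatrix r n) q *ᵥ v) = aeval (casimir k r R) q (tensorEval k a v) := by
  induction q using Polynomial.induction_on generalizing v with
  | C c => simp only [aeval_C, Algebra.algebraMap_eq_smul_one, Matrix.smul_mulVec, Matrix.one_mulVec,
      map_zsmul, LinearMap.smul_apply, Module.End.one_apply]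
  | add p q hp hq => simp [Matrix.add_mulVec, hp, hq]
  | monomial n c h =>
    rw [pow_succ, ← mul_assoc, map_mul (aeval _) (C c * X ^ n), map_mul (aeval _) (C c * X ^ n),
      ← Matrix.mulVec_mulVec, h, aeval_X, aeval_X,
      tensorEval_casimirMatrix, Module.End.mul_apply]

open Classical in
theorem sum_embedding {α : Type*} [AddCommMonoid α] {n : ℕ} (f : (Fin n → Fin r) → α) :
    ∑ I : Fin n ↪ Fin r, f I = ∑ I : Fin n → Fin r, if Function.Injective I then f I else 0 := by
  rw [← Finset.sum_filter, Finset.sum_subtype _ (p := Function.Injective) (by simp),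
    ← Equiv.sum_comp (Equiv.subtypeInjectiveEquivEmbedding _ _)]
  rfl

/-- In the stable range, a matrix which annihilates the image of `gl_r` on the right is determined
up to a multiple by its columns with pairwise distinct row indices. -/
theorem card_smul_col {n : ℕ} (hn : n ≤ r) {Q : Matrix (TensorIndex n r) (TensorIndex n r) ℤ}
    (hQ : ∀ x : Fin r × Fin r, Q * adMatrix x.1 x.2 = 0) (i j : Fin n → Fin r) :
    Fintype.card (Fin n ↪ Fin r) • Q.col (i, j) = ∑ σ : Equiv.Perm (Fin n), if j = i ∘ σ then
      ∑ I : Fin n ↪ Fin r, Q.col (I, I ∘ σ) else 0 := by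
  funext y
  -- Every row of Q is a functional that vanishes on the image of the action.
  have hl : IsInvariant (Q y) := isInvariant_of_mul_adMatrix fun p q x => by
    simpa [Matrix.mul_apply] using congrFun (congrFun (hQ (p, q)) y) x
  -- Any injection I may serve as base tuple; summing over all of them produces the multiple on the
  -- left and the sum that appears in `kappaSection`.
  have e : ∀ I : Fin n ↪ Fin r, Q y (i, j) = _ := fun I => hl.eq_sum_perm hn I.injective i j
  have : Fintype.card (Fin n ↪ Fin r) • Q y (i, j) = ∑ I : Fin n ↪ Fin r,
      ∑ σ : Equiv.Perm (Fin n), if j = i ∘ σ then Q y (I, I ∘ σ) else 0 := by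
    simp_rw [← fun I : Fin n ↪ Fin r => e I]
    simp
  rw [Finset.sum_comm] at this
  simp only [Pi.smul_apply, Matrix.col_apply, Finset.sum_apply, this]
  refine Finset.sum_congr rfl fun σ _ => ?_
  split_ifs <;> simp

theorem mem_span_glProd {n : ℕ} {z : Chevalley k (Matrix (Fin r) (Fin r) R)}
    (hz : z ∈ chevDeg k (Matrix (Fin r) (Fin r) R) n) :
    z ∈ Submodule.span k {s | ∃ (i j : Fin n → Fin r) (a : Fin n → R), s = glProd k i j a} := by
  refine chevDeg_induction k (P := fun n z => z ∈ Submodule.span k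
    {s | ∃ (i j : Fin n → Fin r) (a : Fin n → R), s = glProd k i j a}) ?_ ?_ ?_ ?_ hz
  · exact Submodule.subset_span ⟨Fin.elim0, Fin.elim0, Fin.elim0, by simp⟩
  · intro n a b ha hb; exact add_mem ha hb
  · intro n c a ha; exact Submodule.smul_mem _ _ ha
  · intro n x s hs' hs
    clear hs'
    induction hs using Submodule.span_induction with
    | mem s hs =>
      obtain ⟨i, j, a, rfl⟩ := hs
      rw [Matrix.matrix_eq_sum_single x, map_sum, Finset.sum_mul]
      refine Submodule.sum_mem _ fun p _ => ?_
      rw [map_sum, Finset.sum_mul]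
      refine Submodule.sum_mem _ fun q _ => Submodule.subset_span
        ⟨Fin.cons p i, Fin.cons q j, Fin.cons (x p q) a, ?_⟩
      simp [glProd_succ]
    | zero => simp
    | add a b _ _ ha hb => rw [mul_add]; exact add_mem ha hb
    | smul c a _ ha => rw [mul_smul_comm]; exact Submodule.smul_mem _ _ ha

/-- On a product of elementary matrices both sides are values of columns of the integer matrix q(Ω).
The relation between these columns in `card_smul_col` has the same shape as the formula
`kappaSection_kappa`. -/
theorem card_smul_aeval_casimir {n : ℕ} (hn : n ≤ r) {q : ℤ[X]}
    (hq : ∀ x : Fin r × Fin r, aeval (casimirMatrix r n) q * adMatrix x.1 x.2 = 0)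
    {z : Chevalley k (Matrix (Fin r) (Fin r) R)}
    (hz : z ∈ chevDeg k (Matrix (Fin r) (Fin r) R) n) :
    Fintype.card (Fin n ↪ Fin r) • aeval (casimir k r R) q z =
      aeval (casimir k r R) q (kappaSection k (kappa k (Fin r) R z)) := by
  have hs := mem_span_glProd k hz
  clear hz
  induction hs using Submodule.span_induction with
  | zero => simp
  | add a b _ _ ha hb => simp only [map_add, smul_add, ha, hb]
  | smul c a _ ha => simp only [map_smul, smul_comm _ c, ha]
  | mem s hs =>
    obtain ⟨i, j, a, rfl⟩ := hs
    have e : ∀ x : TensorIndex n r, aeval (casimir k r R) q (glProd k x.1 x.2 a) =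
        tensorEval k a ((aeval (casimirMatrix r n) q).col x) := fun x => by
      rw [← Matrix.mulVec_single_one, tensorEval_aeval, tensorEval_single]
    rw [e (i, j), ← map_nsmul, card_smul_col hn hq, kappaSection_kappa, map_sum, map_sum]
    refine Finset.sum_congr rfl fun σ _ => ?_
    split_ifs
    · rw [← sum_embedding fun I : Fin n → Fin r => glProd k I (I ∘ σ) a, map_sum, map_sum]
      exact Finset.sum_congr rfl fun I _ => (e (I, I ∘ σ)).symm
    · simp

/-- Both sides are derivations along `matWord`, so only single letters need checking. -/
theorem matWord_adWord_single {m : Type*} [Fintype m] [DecidableEq m] (p q : m)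
    (w : TensorAlgebra k (Matrix m m R)) :
    matWord k m R (adWord k (single p q (1 : R)) w) =
      single p q 1 * matWord k m R w - matWord k m R w * single p q 1 := by
  induction w using word_induction with
  | one => simp
  | add a b ha hb => simp only [map_add, ha, hb, mul_add, add_mul]; abel
  | smul c a ha => simp only [map_smul, ha, smul_sub, mul_smul_comm, smul_mul_assoc]
  | mul y w hw =>
    have e : matWord k m R (ι k ⁅single p q (1 : R), y⁆) =
        single p q 1 * matWord k m R (ι k y) - matWord k m R (ι k y) * single p q 1 := by
      ext i j
      simp [matWord, Ring.lie_def, Matrix.mul_apply, Matrix.single_apply, ite_and]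
      congr 1 <;> split_ifs <;> simp
    rw [adWord_mul, map_add, map_mul, map_mul, map_mul, hw, e]
    noncomm_ring

/-- The trace of a commutator need not vanish over the noncommutative tensor algebra, but the
entries 0 and 1 of E_pq are central. The cancellation takes place before passing to cyclic words. -/
theorem connesTrace_connesAd_single {m : Type*} [Fintype m] [DecidableEq m] (p q : m)
    (u : Connes k (Matrix m m R)) :
    connesTrace k m R (connesAd k (single p q (1 : R)) u) = 0 := by
  induction u using connes_induction with | h w
  rw [connesAd_cyc, connesTrace_cyc]
  simp [traceWord, matWord_adWord_single, Matrix.trace, Matrix.mul_apply, Matrix.single_apply,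
    ite_and]

theorem symTrace_symAd_single {m : Type*} [Fintype m] [DecidableEq m] (p q : m)
    (s : ConnesSym k (Matrix m m R)) : symTrace k m R (symAd k (single p q (1 : R)) s) = 0 := by
  induction s using sym_induction with
  | one => simp
  | add a b ha hb => simp [ha, hb]
  | smul c a ha => simp [ha]
  | mul u s hs => simp [hs, connesTrace_connesAd_single]

/-- This puts the chain built in `exists_smul_boundary` in Ker κ. -/
theorem kappa_chevAd_single (p q : Fin r) (s : Chevalley k (Matrix (Fin r) (Fin r) R)) :
    kappa k (Fin r) R (chevAd k (single p q (1 : R)) s) = 0 := by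
  simp [kappa, cycleMap_chevAd, symTrace_symAd_single]

theorem chevD_casimir (s : Chevalley k (Matrix (Fin r) (Fin r) R)) :
    chevD k _ (casimir k r R s) = casimir k r R (chevD k _ s) := by
  simp only [casimir_apply, map_sum, chevD_chevAd]

theorem chevD_aeval_casimir (q : ℤ[X]) (s : Chevalley k (Matrix (Fin r) (Fin r) R)) :
    chevD k _ (aeval (casimir k r R) q s) = aeval (casimir k r R) q (chevD k _ s) := by
  induction q using Polynomial.induction_on generalizing s with
  | C c => simp only [aeval_C, Algebra.algebraMap_eq_smul_one, map_zsmul, LinearMap.smul_apply,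
      Module.End.one_apply]
  | add p q hp hq => simp [hp, hq]
  | monomial n c h =>
    rw [pow_succ, ← mul_assoc, map_mul (aeval _) (C c * X ^ n), aeval_X, Module.End.mul_apply,
      h, chevD_casimir, Module.End.mul_apply]

theorem aeval_casimir_mem {n : ℕ} (q : ℤ[X]) {s : Chevalley k (Matrix (Fin r) (Fin r) R)}
    (hs : s ∈ chevDeg k (Matrix (Fin r) (Fin r) R) n) :
    aeval (casimir k r R) q s ∈ chevDeg k (Matrix (Fin r) (Fin r) R) n := by
  induction q using Polynomial.induction_on generalizing s with
  | C c =>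
    simp only [aeval_C, Algebra.algebraMap_eq_smul_one, LinearMap.smul_apply, Module.End.one_apply]
    exact zsmul_mem hs c
  | add p q hp hq => rw [map_add, LinearMap.add_apply]; exact add_mem (hp hs) (hq hs)
  | monomial n c h =>
    rw [pow_succ, ← mul_assoc, map_mul (aeval _) (C c * X ^ n), aeval_X, Module.End.mul_apply]
    refine h ?_
    rw [casimir_apply]
    exact sum_mem fun x _ => chevAd_mem k _ (chevAd_mem k _ hs)

/-- In the stable range, the cycles in the kernel of the Loday–Quillen–Tsygan map become boundaries
in the kernel after multiplication by a nonzero integer depending only on `n` and `r`. -/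
theorem exists_smul_boundary {n : ℕ} (hn : n ≤ r) : ∃ c : ℤ, c ≠ 0 ∧ ∀ (k R : Type*) [CommRing k]
    [Ring R] [Algebra k R] (z : Chevalley k (Matrix (Fin r) (Fin r) R)),
      z ∈ chevDeg k (Matrix (Fin r) (Fin r) R) n → chevD k _ z = 0 → kappa k (Fin r) R z = 0 →
      ∃ y ∈ chevDeg k (Matrix (Fin r) (Fin r) R) (n + 1),
        kappa k (Fin r) R y = 0 ∧ chevD k _ y = c • z := by
  -- This choice precedes the choice of k and R, so q(0) depends only on n and r.
  obtain ⟨q, hq0, hq⟩ := exists_aeval_mul_eq_zero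
    (fun x : Fin r × Fin r => (adMatrix x.1 x.2 : Matrix (TensorIndex n r) _ ℤ))
  -- There is an injection because n ≤ r.
  have hN : Fintype.card (Fin n ↪ Fin r) ≠ 0 :=
    @Fintype.card_ne_zero _ _ ⟨Fin.castLEEmb hn⟩
  refine ⟨(Fintype.card (Fin n ↪ Fin r) : ℤ) * q.coeff 0, mul_ne_zero (by exact_mod_cast hN) hq0, ?_⟩
  intro k R _ _ _ z hz hdz hκz
  have h1 := card_smul_aeval_casimir k hn hq hz
  rw [hκz, map_zero, map_zero] at h1
  set N := Fintype.card (Fin n ↪ Fin r)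
  -- With q = X q₁ + q(0), z' = q₁(Ω) z; it is a cycle because Ω commutes with d.
  set z' := aeval (casimir k r R) q.divX z with hz'
  have hz'mem : z' ∈ chevDeg k (Matrix (Fin r) (Fin r) R) n := aeval_casimir_mem k _ hz
  have hdz' : chevD k _ z' = 0 := by rw [hz', chevD_aeval_casimir, hdz, map_zero]
  have h2 : aeval (casimir k r R) q z = casimir k r R z' + q.coeff 0 • z := by
    conv_lhs => rw [← q.X_mul_divX_add]
    rw [map_add, map_mul, aeval_X, aeval_C, LinearMap.add_apply, Module.End.mul_apply,
      Algebra.algebraMap_eq_smul_one, LinearMap.smul_apply, Module.End.one_apply]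
  -- Since z' is a cycle, d(E_qp ∧ z') = E_qp · z', and applying the outer E_pq, which commutes with
  -- d, gives Ω z' after summation. The outer action is also what places the chain in Ker κ. The
  -- sign comes from N (Ω z' + q(0) z) = 0.
  refine ⟨-(N • ∑ x : Fin r × Fin r, chevAd k (single x.1 x.2 (1 : R))
    (chevι k (single x.2 x.1 (1 : R)) * z')), ?_, ?_, ?_⟩
  · exact neg_mem (nsmul_mem (sum_mem fun x _ => chevAd_mem k _ (chevι_mul_mem k _ hz'mem)) N)
  · simp only [map_neg, map_nsmul, map_sum, kappa_chevAd_single, Finset.sum_const_zero, smul_zero,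
      neg_zero]
  · simp only [map_neg, map_nsmul, map_sum, chevD_chevAd, chevD_mul, hdz', mul_zero, sub_zero,
      ← casimir_apply]
    rw [h2, smul_add] at h1
    rw [mul_smul, natCast_zsmul]
    exact (neg_eq_of_add_eq_zero_right h1)

end Casimir

/-! ### Passage to the homology of the kernel complex -/

section Homology

universe u

/-- The homology in degree `n` of a kernel of chain complexes of modules is killed by `c` if every
cycle in the kernel becomes a boundary in the kernel after multiplication by `c`. -/
theorem smul_homology_kernel_eq_zero {K L : ChainComplex (ModuleCat.{u} ℤ) ℕ} (f : K ⟶ L) (c : ℤ)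
    (n : ℕ) (h : ∀ z : K.X n, (∀ m, K.d n m z = 0) → f.f n z = 0 →
      ∃ y : K.X (n + 1), f.f (n + 1) y = 0 ∧ K.d (n + 1) n y = c • z) :
    c • 𝟙 ((kernel f).homology n) = 0 := by
  have hι : ∀ i, Function.Injective ((kernel.ι f).f i) := fun i =>
    (ModuleCat.mono_iff_injective _).1 inferInstance
  -- Evaluation in a fixed degree is exact, so the categorical kernel is the kernel of modules in
  -- each degree.
  have hex : ∀ i (y : K.X i), f.f i y = 0 → ∃ x, (kernel.ι f).f i x = y := fun i => by
    have := (ShortComplex.exact_of_f_is_kernel (ShortComplex.mk (kernel.ι f) f (kernel.condition f))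
      (kernelIsKernel f)).map (HomologicalComplex.eval (ModuleCat.{u} ℤ) (ComplexShape.down ℕ) i)
    exact (ShortComplex.moduleCat_exact_iff _).1 this
  -- Cycles surject onto homology, so the claim is tested on a cycle x.
  rw [← cancel_epi ((kernel f).homologyπ n), comp_zero, Preadditive.comp_zsmul, Category.comp_id]
  ext x
  set w := (kernel f).iCycles n x with hw
  obtain ⟨y, hy, hdy⟩ := h ((kernel.ι f).f n w) (fun m => by
      rw [← ModuleCat.comp_apply, (kernel.ι f).comm, ModuleCat.comp_apply, hw,
        ← ModuleCat.comp_apply ((kernel f).iCycles n), HomologicalComplex.iCycles_d]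
      simp) (by
      rw [← ModuleCat.comp_apply, ← HomologicalComplex.comp_f, kernel.condition]
      rfl)
  obtain ⟨y', rfl⟩ := hex (n + 1) y hy
  have hd : (kernel f).d (n + 1) n y' = c • w := hι n (by
    rw [map_zsmul, ← hdy, ← ModuleCat.comp_apply, ← (kernel.ι f).comm, ModuleCat.comp_apply])
  -- The inclusion of cycles is injective, so the identity of chains just found is one of cycles.
  have hcyc : (kernel f).toCycles (n + 1) n y' = c • x := by
    refine (ModuleCat.mono_iff_injective ((kernel f).iCycles n)).1 inferInstance ?_
    rw [map_zsmul, ← hw, ← hd, ← ModuleCat.comp_apply, HomologicalComplex.toCycles_i]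
  change c • (kernel f).homologyπ n x = 0
  rw [← map_zsmul, ← hcyc, ← ModuleCat.comp_apply, HomologicalComplex.toCycles_comp_homologyπ]
  rfl

theorem chevD_eq_zero_of_mem_zero (k : Type*) [CommRing k] {L : Type*} [LieRing L] [LieAlgebra k L]
    {s : Chevalley k L} (hs : s ∈ chevDeg k L 0) : chevD k L s = 0 := by
  rw [chevDeg, pow_zero] at hs
  obtain ⟨a, rfl⟩ := Submodule.mem_one.1 hs
  simp [Algebra.algebraMap_eq_smul_one]

theorem exists_smul_homology_eq_zero {r n : ℕ} (hn : n ≤ r) : ∃ c : ℤ, c ≠ 0 ∧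
    ∀ (R : Type u) [Ring R], c • 𝟙 ((kernel (lodayQuillenTsygan ℤ r R)).homology n) = 0 := by
  obtain ⟨c, hc, h⟩ := exists_smul_boundary.{0, u} hn
  refine ⟨c, hc, fun R _ => smul_homology_kernel_eq_zero _ c n fun z hz hκ => ?_⟩
  obtain ⟨z, hzm⟩ := z
  -- In degree 0 the complex has no outgoing differential to supply this, but `chevD` vanishes there
  -- because the degree 0 part consists of multiples of 1.
  have hdz : chevD ℤ (Matrix (Fin r) (Fin r) R) z = 0 := by
    cases n with
    | zero => exact chevD_eq_zero_of_mem_zero ℤ hzm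
    | succ n =>
      have := hz n
      rw [chevalleyComplex_d] at this
      exact congrArg Subtype.val this
  obtain ⟨y, hym, hκy, hdy⟩ := h ℤ R z hzm hdz (congrArg Subtype.val hκ)
  refine ⟨⟨y, hym⟩, Subtype.ext hκy, ?_⟩
  rw [chevalleyComplex_d]
  exact Subtype.ext hdy

end Homology
end LQT

/-- For every `r` there is a nonzero integer `c` killing `H_n Ker(κ^r_R)` for every ring `R` and
every `n ≤ r`, where `κ^r_R : C(gl_r(R)) → Sym(C^λ(R)[1])` is the Loday–Quillen–Tsygan map. -/
theorem mainTheorem7 (r : ℕ) :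
    ∃ c : ℤ, c ≠ 0 ∧ ∀ (R : Type*) [Ring R] (n : ℕ), n ≤ r →
      c • 𝟙 ((kernel (LQT.lodayQuillenTsygan ℤ r R)).homology n) = 0 := by
  choose c hc h using fun n : Fin (r + 1) => LQT.exists_smul_homology_eq_zero (Nat.lt_succ_iff.1 n.2)
  -- The product over all degrees at most r is a nonzero multiple of each constant, so one integer
  -- works in every degree.
  refine ⟨∏ n, c n, Finset.prod_ne_zero_iff.2 fun n _ => hc n, fun R _ n hn => ?_⟩
  obtain ⟨d, hd⟩ := Finset.dvd_prod_of_mem c (Finset.mem_univ ⟨n, Nat.lt_succ_of_le hn⟩)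
  rw [hd, mul_comm, mul_smul]
  exact (congrArg (d • ·) (h ⟨n, Nat.lt_succ_of_le hn⟩ R)).trans (smul_zero d)
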